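/- Let $\mu$ be a positive Borel measure on $\mathbb R$ with infinite support and finite moments $s_n=\int x^n\,d\mu(x)$, $n\ge 0$, and assume that $\mu$ is indeterminate, i.e. some positive measure different from $\mu$ has the same moments. For $N\ge 0$ let $\mathcal H_N=(s_{j+k})_{j,k=0}^N$, and let $\lambda_{N,0}\le\lambda_{N,1}\le\dots\le\lambda_{N,N}$ be its $N+1$ eigenvalues, counted with multiplicity. Let $P_n(x)=\sum_{k=0}^n b_{k,n}x^k$, $n\ge 0$, be the orthonormal polynomials of $\mu$ ($\deg P_n=n$, positive leading coefficient, $\int P_mP_n\,d\mu=\delta_{mn}$), let $\mathcal B=(b_{k,n})_{k,n\ge 0}$ with $b_{k,n}=0$ for $k>n$, and let $\mathcal A=(a_{j,k})_{j,k\ge 0}$ be the matrix of coefficients of $$K(z,w)=\sum_{n=0}^\infty P_n(z)P_n(w)=\sum_{j,k=0}^\infty a_{j,k}z^jw^k,\qquad z,w\in\mathbb C .$$ For a compact operator $T$ on $\ell^2=\ell^2(\{0,1,2,\dots\};\mathbb C)$ let $$\sigma_n(T)=\min_{V\subset\ell^2,\ \dim V=n}\ \ \max_{\|v\|=1,\ v\perp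 V}\|Tv\|,\qquad n=0,1,2,\dots$$ be its singular values in decreasing order. Then both series for $K(z,w)$ converge for all $z,w\in\mathbb C$, the matrices $\mathcal A$ and $\mathcal B$ define bounded operators on $\ell^2$, $\mathcal A$ and $\mathcal B^*$ are compact, all $\lambda_{N,n}$ ($0\le n\le N$) are positive, and for every $n\ge 0$ the limit $\lambda_{\infty,n}=\lim_{N\to\infty}\lambda_{N,n}$ exists and is positive. Moreover, for $0\le n\le N$, $$\sigma_n(\mathcal A)=\sigma_n(\mathcal B^*)^2\ \ge\ \frac1{\lambda_{\infty,n}}\ \ge\ \frac1{\lambda_{N,n}},$$ and $$\lim_{n\to\infty}n^2\,\sigma_n(\mathcal A)^{1/n}=0,\qquad \lim_{n\to\infty}\frac{\lambda_{\infty,n}^{1/n}}{n^2}=\infty .$$ -/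

import Mathlib

open MeasureTheory Filter Topology Polynomial

/-- All moments of `μ` exist (as absolutely convergent integrals); for `n = 0` this says that `μ` is
a finite measure. -/
def HasAllMoments (μ : Measure ℝ) : Prop :=
  ∀ n : ℕ, Integrable (fun x : ℝ => x ^ n) μ

/-- The `n`-th moment `s_n = ∫ x ^ n dμ(x)`. -/
noncomputable def moment (μ : Measure ℝ) (n : ℕ) : ℝ := ∫ x, x ^ n ∂μ

/-- `μ` is indeterminate: some other positive measure has the same moments. -/
def IsIndeterminate (μ : Measure ℝ) : Prop :=
  ∃ ν : Measure ℝ, ν ≠ μ ∧ HasAllMoments ν ∧ ∀ n : ℕ, moment ν n = moment μ n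

/-- The Hankel matrix `H_N = (s_{n+m})_{n,m=0}^N`. -/
noncomputable def hankel (μ : Measure ℝ) (N : ℕ) : Matrix (Fin (N + 1)) (Fin (N + 1)) ℝ :=
  Matrix.of fun i j => moment μ (i.val + j.val)

theorem hankel_isHermitian (μ : Measure ℝ) (N : ℕ) : (hankel μ N).IsHermitian := by
  ext i j
  simp [hankel, add_comm]

/-- `λ_{N,n}`: for `0 ≤ n ≤ N`, the `n`-th entry (counted from `0`) in the *increasing* list of the
`N + 1` eigenvalues of `H_N`, repeated according to multiplicity. Mathlib's `eigenvalues₀` is the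
*decreasing* list, so this is its entry with index `N - n`. (The value is irrelevant for `n > N`.) -/
noncomputable def hankelEigenvalue (μ : Measure ℝ) (N n : ℕ) : ℝ :=
  if n ≤ N then (hankel_isHermitian μ N).eigenvalues₀ ⟨N - n, by simp⟩ else 0

/-- `λ_{∞,n} = lim_{N → ∞} λ_{N,n}`. -/
noncomputable def limitEigenvalue (μ : Measure ℝ) (n : ℕ) : ℝ :=
  limUnder atTop fun N : ℕ => hankelEigenvalue μ N n

/-- The conditions that determine the orthonormal polynomials of `μ`: `P n` has degree `n` and
positive leading coefficient, and `∫ P_m P_n dμ = δ_{mn}`. -/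
def IsOrthonormalPolynomials (μ : Measure ℝ) (P : ℕ → ℝ[X]) : Prop :=
  (∀ n, (P n).degree = n ∧ 0 < (P n).leadingCoeff) ∧
    ∀ m n, ∫ x, (P m).eval x * (P n).eval x ∂μ = if m = n then 1 else 0

/-- The orthonormal polynomials of `μ`, by the Gram-Schmidt process applied to `1, x, x ^ 2, …`:
`P_n = q_n / (∫ q_n ^ 2 dμ) ^ (1 / 2)` with `q_n = x ^ n - ∑_{k < n} (∫ y ^ n P_k(y) dμ(y)) P_k`. -/
noncomputable def orthoPoly (μ : Measure ℝ) (n : ℕ) : ℝ[X] :=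
  let q : ℝ[X] := X ^ n - ∑ k : Fin n,
    C (∫ x, x ^ n * (orthoPoly μ k.val).eval x ∂μ) * orthoPoly μ k.val
  C (Real.sqrt (∫ x, q.eval x ^ 2 ∂μ))⁻¹ * q
termination_by n
decreasing_by all_goals exact k.isLt

theorem integrable_eval {μ : Measure ℝ} (h : HasAllMoments μ) (p : ℝ[X]) :
    Integrable (fun x => p.eval x) μ := by
  simp only [Polynomial.eval_eq_sum_range]
  exact integrable_finsetSum _ fun i _ => (h i).const_mul _

theorem integrable_eval_mul {μ : Measure ℝ} (h : HasAllMoments μ) (p q : ℝ[X]) :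
    Integrable (fun x => p.eval x * q.eval x) μ := by
  simpa using integrable_eval h (p * q)

theorem integral_eval_sq_pos {μ : Measure ℝ} (h : HasAllMoments μ) (hs : μ.support.Infinite)
    {p : ℝ[X]} (hp : p ≠ 0) : 0 < ∫ x, p.eval x ^ 2 ∂μ := by
  have hint : Integrable (fun x => p.eval x ^ 2) μ := by
    simpa only [pow_two] using integrable_eval_mul h p p
  refine lt_of_le_of_ne (integral_nonneg fun x => sq_nonneg _) fun h0 => ?_
  have h1 := (integral_eq_zero_iff_of_nonneg (fun x => sq_nonneg _) hint).1 h0.symm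
  have hsub : μ.support ⊆ {x | p.eval x = 0} := by
    refine Measure.support_subset_of_isClosed
      (isClosed_singleton.preimage p.continuous) ?_
    filter_upwards [h1] with x hx
    simpa using hx
  refine hs ((p.roots.toFinset.finite_toSet).subset fun x hx => ?_)
  simpa [hp] using hsub hx

/-- The construction does produce the orthonormal polynomials. -/
theorem orthoPoly_isOrthonormalPolynomials {μ : Measure ℝ} (h : HasAllMoments μ)
    (hs : μ.support.Infinite) : IsOrthonormalPolynomials μ (orthoPoly μ) := by
  have key : ∀ n, ((orthoPoly μ n).degree = n ∧ 0 < (orthoPoly μ n).leadingCoeff) ∧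
      ∀ m ≤ n, ∫ x, (orthoPoly μ m).eval x * (orthoPoly μ n).eval x ∂μ
        = if m = n then 1 else 0 := by
    intro n
    induction n using Nat.strong_induction_on with
    | _ n ih =>
      obtain ⟨q, hq⟩ : ∃ q : ℝ[X], q = X ^ n - ∑ k : Fin n,
        C (∫ x, x ^ n * (orthoPoly μ k.val).eval x ∂μ) * orthoPoly μ k.val := ⟨_, rfl⟩
      have hP : orthoPoly μ n = C (Real.sqrt (∫ x, q.eval x ^ 2 ∂μ))⁻¹ * q := by
        rw [orthoPoly, hq]
      have hdeg : (∑ k : Fin n,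
          C (∫ x, x ^ n * (orthoPoly μ k.val).eval x ∂μ) * orthoPoly μ k.val).degree
            < ((X : ℝ[X]) ^ n).degree := by
        rw [degree_X_pow]
        refine (degree_sum_le _ _).trans_lt
          ((Finset.sup_lt_iff (WithBot.bot_lt_coe n)).2 fun k _ => ?_)
        have hk : (orthoPoly μ k.val).degree < n := by
          rw [(ih k.val k.isLt).1.1]
          exact_mod_cast k.isLt
        rw [← smul_eq_C_mul]
        exact (degree_smul_le _ _).trans_lt hk
      have hqd : q.degree = n := by
        rw [hq, degree_sub_eq_left_of_degree_lt hdeg, degree_X_pow]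
      have hql : q.leadingCoeff = 1 := by
        rw [hq, leadingCoeff_sub_of_degree_lt hdeg, leadingCoeff_X_pow]
      have hq0 : q ≠ 0 := by
        intro h0
        simp [h0] at hql
      have hpos := integral_eval_sq_pos h hs hq0
      have hc : 0 < (Real.sqrt (∫ x, q.eval x ^ 2 ∂μ))⁻¹ := inv_pos.2 (Real.sqrt_pos.2 hpos)
      refine ⟨⟨?_, ?_⟩, fun m hm => ?_⟩
      · rw [hP, degree_C_mul hc.ne', hqd]
      · rw [hP, leadingCoeff_mul, leadingCoeff_C, hql, mul_one]
        exact hc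
      rcases hm.lt_or_eq with hlt | rfl
      · rw [if_neg hlt.ne, hP]
        have e : ∀ x, (orthoPoly μ m).eval x *
            (C (Real.sqrt (∫ x, q.eval x ^ 2 ∂μ))⁻¹ * q).eval x =
            (Real.sqrt (∫ x, q.eval x ^ 2 ∂μ))⁻¹ * ((orthoPoly μ m).eval x * q.eval x) := by
          intro x
          simp only [eval_mul, eval_C]
          ring
        simp only [e]
        rw [integral_const_mul]
        refine mul_eq_zero_of_right _ ?_
        have e2 : ∀ x, (orthoPoly μ m).eval x * q.eval x =
            x ^ n * (orthoPoly μ m).eval x - ∑ k : Fin n,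
              (∫ x, x ^ n * (orthoPoly μ k.val).eval x ∂μ) *
                ((orthoPoly μ m).eval x * (orthoPoly μ k.val).eval x) := by
          intro x
          rw [hq]
          simp only [eval_sub, eval_pow, eval_X, eval_finsetSum, eval_mul, eval_C, mul_sub,
            Finset.mul_sum]
          congr 1
          · ring
          · exact Finset.sum_congr rfl fun k _ => by ring
        simp only [e2]
        rw [integral_sub, integral_finsetSum]
        · have e3 : ∀ k : Fin n, ∫ x, (∫ x, x ^ n * (orthoPoly μ k.val).eval x ∂μ) *
              ((orthoPoly μ m).eval x * (orthoPoly μ k.val).eval x) ∂μ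
              = if k = ⟨m, hlt⟩ then ∫ x, x ^ n * (orthoPoly μ m).eval x ∂μ else 0 := by
            intro k
            rw [integral_const_mul]
            have e4 : ∫ x, (orthoPoly μ m).eval x * (orthoPoly μ k.val).eval x ∂μ
                = if m = k.val then 1 else 0 := by
              rcases le_total m k.val with hmk | hmk
              · exact (ih k.val k.isLt).2 m hmk
              · have := (ih m hlt).2 k.val hmk
                simp only [mul_comm ((orthoPoly μ m).eval _)]
                rw [this]
                simp only [eq_comm]
            rw [e4]
            by_cases hk : m = k.val
            · subst hk
              simp
            · rw [if_neg hk, if_neg (fun hh => hk (by rw [hh])), mul_zero]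
          simp [e3]
        · exact fun k _ => (integrable_eval_mul h _ _).const_mul _
        · simpa using integrable_eval_mul h (X ^ n) (orthoPoly μ m)
        · exact integrable_finsetSum _ fun k _ => (integrable_eval_mul h _ _).const_mul _
      · rw [if_pos rfl, hP]
        have e : ∀ x, (C (Real.sqrt (∫ x, q.eval x ^ 2 ∂μ))⁻¹ * q).eval x *
            (C (Real.sqrt (∫ x, q.eval x ^ 2 ∂μ))⁻¹ * q).eval x =
            (∫ x, q.eval x ^ 2 ∂μ)⁻¹ * q.eval x ^ 2 := by
          intro x
          have := Real.mul_self_sqrt hpos.le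
          calc _ = (Real.sqrt (∫ x, q.eval x ^ 2 ∂μ) *
                Real.sqrt (∫ x, q.eval x ^ 2 ∂μ))⁻¹ * q.eval x ^ 2 := by
                simp only [eval_mul, eval_C, mul_inv]
                ring
            _ = _ := by rw [this]
        simp only [e]
        rw [integral_const_mul, inv_mul_cancel₀ hpos.ne']
  refine ⟨fun n => (key n).1, fun m n => ?_⟩
  rcases le_total m n with hmn | hmn
  · exact (key n).2 m hmn
  · have := (key m).2 n hmn
    simp only [mul_comm ((orthoPoly μ m).eval _)]
    rw [this]
    simp only [eq_comm]

/-- The kernel `K(z,w) = ∑_{n=0}^∞ P_n(z) P_n(w)` for complex `z, w`. -/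
noncomputable def kernelK (μ : Measure ℝ) (z w : ℂ) : ℂ :=
  ∑' n : ℕ, aeval z (orthoPoly μ n) * aeval w (orthoPoly μ n)

/-- The Hilbert space `ℓ²` of square summable complex sequences indexed by `0, 1, 2, …`. -/
abbrev EllTwo : Type := lp (fun _ : ℕ => ℂ) 2

/-- The matrix entry `T_{j,k} = ⟨T δ_k, δ_j⟩` of a bounded operator on `ℓ²`, where `(δ_k)` is the
standard orthonormal basis. A bounded operator is determined by its matrix. -/
noncomputable def entry (T : EllTwo →L[ℂ] EllTwo) (j k : ℕ) : ℂ :=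
  T (lp.single 2 k (1 : ℂ)) j

/-- `B` is the operator of the upper triangular matrix `(b_{k,n})`, where
`P_n(x) = ∑_{k=0}^n b_{k,n} x ^ k`. -/
def IsOperatorB (μ : Measure ℝ) (B : EllTwo →L[ℂ] EllTwo) : Prop :=
  ∀ k n : ℕ, entry B k n = (((orthoPoly μ n).coeff k : ℝ) : ℂ)

/-- `A` is the operator of the matrix `(a_{j,k})` of power series coefficients of the kernel:
the series for `K(z,w)` converges, and `K(z,w) = ∑_{j,k} a_{j,k} z ^ j w ^ k`,
for all complex `z, w`. -/
def IsOperatorA (μ : Measure ℝ) (A : EllTwo →L[ℂ] EllTwo) : Prop :=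
  ∀ z w : ℂ, Summable (fun n : ℕ => aeval z (orthoPoly μ n) * aeval w (orthoPoly μ n)) ∧
    HasSum (fun p : ℕ × ℕ => entry A p.1 p.2 * z ^ p.1 * w ^ p.2) (kernelK μ z w)

/-- The singular values `σ_0(T) ≥ σ_1(T) ≥ …` of a compact operator `T` on `ℓ²`:
`σ_n(T) = min_{dim V = n} max {‖T v‖ | ‖v‖ = 1, v ⟂ V}`. -/
noncomputable def singularValue (T : EllTwo →L[ℂ] EllTwo) (n : ℕ) : ℝ :=
  sInf {r : ℝ | ∃ V : Submodule ℂ EllTwo, Module.rank ℂ V = n ∧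
    r = sSup {t : ℝ | ∃ v : EllTwo, v ∈ Vᗮ ∧ ‖v‖ = 1 ∧ t = ‖T v‖}}

/-! Everything is read off from the rows r_k = (b_{k,n})_n of the coefficient matrix. Let T be the
operator with T δ_k = r_k. The coefficients are real, so T = B*, and A = T*T is the Gram matrix of
the rows. The upper estimate amounts to showing that ‖r_k‖ decays like the Taylor coefficients of an
entire function of minimal exponential type.

Growth. A second solution ν has a Stieltjes transform that differs from that of μ at some nonreal w.
With Q_n(w) the polynomials of the second kind and m a Stieltjes transform, Bessel's inequality
makes Q_n(w) + m(w) P_n(w) square summable for both values of m(w), hence P_n(w) and Q_n(w)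
separately. Variation of constants based at w writes P_n through the P_k with k < n, and a Gronwall
argument bounds the ℓ¹ size of its coefficients with weight r^j by h_n ∏ (1 + (r + |w|) h_k²), where
h_n² = |P_n(w)|² + |Q_n(w)|² is summable. Such a product is O(e^{εr}) for every ε > 0. It follows
that the tails τ_n = ∑_{k ≥ n} ‖r_k‖ satisfy n τ_n^{1/n} → 0. Testing the min-max on the span of
δ_0, …, δ_{n-1} gives σ_n(T) ≤ τ_n, and σ_n(A) = σ_n(T)² by the spectral theorem.

Hankel matrices. If a polynomial has coefficient vector x and Fourier coefficients c, then ‖c‖² = xᵀ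
H_N x by Parseval, and T*c = x. For a unit vector x in the span of the eigenvectors of the n + 1
smallest eigenvalues, 1 = ⟨Tx, c⟩ ≤ ‖Tx‖ λ_{N,n}^{1/2}, so σ_n(T)² ≥ 1/λ_{N,n}. Interlacing makes
λ_{N,n} decreasing in N, so the limit exists and is at least σ_n(T)⁻² > 0. The last limit follows by
inversion. -/

/-- `P` is a graded orthonormal family of polynomials for the bilinear form `(p, q) ↦ L (p q)`. -/
structure IsOrthonormalFor (L : ℂ[X] →ₗ[ℂ] ℂ) (P : ℕ → ℂ[X]) : Prop where
  degree_eq : ∀ n, (P n).degree = n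
  orthonormal : ∀ m n, L (P m * P n) = if m = n then 1 else 0

/-! ### Algebra of orthonormal polynomials: expansion and variation of constants -/

namespace IsOrthonormalFor

variable {L : ℂ[X] →ₗ[ℂ] ℂ} {P : ℕ → ℂ[X]}

/-- Induction on n: subtracting the multiple c P_n that cancels the top coefficient lowers the
degree. By the induction hypothesis the remainder is L-orthogonal to P_n, whence c = L (q P_n). -/
theorem expansion (hP : IsOrthonormalFor L P) :
    ∀ (n : ℕ) (q : ℂ[X]), q.degree < n → q = ∑ k ∈ Finset.range n, C (L (q * P k)) * P k := by
  intro n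
  induction n with
  | zero =>
    intro q hq
    have : q = 0 := by
      rw [← degree_eq_bot]
      exact Nat.WithBot.lt_zero_iff.1 (by simpa using hq)
    simp [this]
  | succ n ih =>
    intro q hq
    have hlc : (P n).leadingCoeff ≠ 0 := by
      rw [Ne, leadingCoeff_eq_zero, ← degree_eq_bot, hP.degree_eq]
      exact WithBot.natCast_ne_bot n
    have hnat : (P n).natDegree = n := natDegree_eq_of_degree_eq_some (hP.degree_eq n)
    obtain ⟨c, hc⟩ : ∃ c, c = q.coeff n / (P n).leadingCoeff := ⟨_, rfl⟩
    have hdeg : (q - C c * P n).degree < n := by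
      rw [degree_lt_iff_coeff_zero]
      intro m hm
      rcases hm.eq_or_lt with rfl | hlt
      · rw [coeff_sub, coeff_C_mul, hc]
        have : (P n).coeff n = (P n).leadingCoeff := by rw [leadingCoeff, hnat]
        rw [this, div_mul_cancel₀ _ hlc, sub_self]
      · rw [coeff_sub, coeff_C_mul, coeff_eq_zero_of_natDegree_lt (hnat.trans_lt hlt),
          coeff_eq_zero_of_degree_lt (hq.trans_le (by exact_mod_cast hlt)), mul_zero, sub_zero]
    have hexp := ih _ hdeg
    have hL : ∀ k, L (q * P k) = L ((q - C c * P n) * P k) + c * if n = k then 1 else 0 := by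
      intro k
      rw [← hP.orthonormal, ← smul_eq_mul (a := c), ← map_smul, ← map_add, smul_eq_C_mul]
      congr 1
      ring
    have hn : L ((q - C c * P n) * P n) = 0 := by
      rw [hexp, Finset.sum_mul, map_sum]
      refine Finset.sum_eq_zero fun k hk => ?_
      rw [mul_assoc, ← smul_eq_C_mul, map_smul, hP.orthonormal, if_neg (Finset.mem_range.1 hk).ne,
        smul_zero]
    rw [Finset.sum_range_succ, hL n, hn, if_pos rfl, mul_one, zero_add]
    have hsum : ∑ k ∈ Finset.range n, C (L (q * P k)) * P k = q - C c * P n := by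
      refine Eq.trans (Finset.sum_congr rfl fun k hk => ?_) hexp.symm
      rw [hL k, if_neg (Finset.mem_range.1 hk).ne', mul_zero, add_zero]
    rw [hsum, sub_add_cancel]

theorem map_mul_eq_zero (hP : IsOrthonormalFor L P) {n : ℕ} {q : ℂ[X]} (hq : q.degree < n) :
    L (P n * q) = 0 := by
  rw [hP.expansion n q hq, Finset.mul_sum, map_sum]
  refine Finset.sum_eq_zero fun k hk => ?_
  rw [mul_left_comm, ← smul_eq_C_mul, map_smul, hP.orthonormal, if_neg (Finset.mem_range.1 hk).ne',
    smul_zero]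

/-- Variation of constants with respect to the base point `w`. The numbers `L (P n /ₘ (X - C w))`
are the values at `w` of the polynomials of the second kind. -/
theorem eq_add_mul_sum (hP : IsOrthonormalFor L P) (w : ℂ) (n : ℕ) :
    P n = C ((P n).eval w) + (X - C w) * ∑ k ∈ Finset.range n,
      C ((P k).eval w * L (P n /ₘ (X - C w)) - (P n).eval w * L (P k /ₘ (X - C w))) * P k := by
  have hdiv : ∀ k, (X - C w) * (P k /ₘ (X - C w)) = P k - C ((P k).eval w) := by
    intro k
    have := modByMonic_add_div (P k) (X - C w)
    rw [modByMonic_X_sub_C_eq_C_eval] at this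
    exact eq_sub_of_add_eq' this
  have hle : ∀ k < n, (P k /ₘ (X - C w)).degree < n := fun k hk =>
    (degree_divByMonic_le _ _).trans_lt (by rw [hP.degree_eq]; exact_mod_cast hk)
  have hdeg : (P n /ₘ (X - C w)).degree < n := by
    rcases Nat.eq_zero_or_pos n with rfl | hn
    · have h0 : P 0 /ₘ (X - C w) = 0 := by
        rw [divByMonic_eq_zero_iff (monic_X_sub_C w), hP.degree_eq, degree_X_sub_C]
        exact_mod_cast Nat.zero_lt_one
      rw [h0, degree_zero]
      exact WithBot.bot_lt_coe 0
    · have hne : P n ≠ 0 := by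
        rw [Ne, ← degree_eq_bot, hP.degree_eq]
        exact WithBot.natCast_ne_bot n
      have := degree_divByMonic_lt (P n) (X - C w) hne
        (by rw [degree_X_sub_C]; exact zero_lt_one)
      rwa [hP.degree_eq] at this
  have hcoef : ∀ k ∈ Finset.range n, L (P n /ₘ (X - C w) * P k) =
      (P k).eval w * L (P n /ₘ (X - C w)) - (P n).eval w * L (P k /ₘ (X - C w)) := by
    intro k hk
    -- Write Q_k for P_k /ₘ (X - w). Eliminating X - w between the identities `hdiv` for n and k
    -- gives this formula, and L annihilates P_n Q_k because deg Q_k < n.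
    have e : P n /ₘ (X - C w) * P k = (P n * (P k /ₘ (X - C w))
        - (P n).eval w • (P k /ₘ (X - C w))) + (P k).eval w • (P n /ₘ (X - C w)) := by
      rw [smul_eq_C_mul, smul_eq_C_mul]
      linear_combination (P k /ₘ (X - C w)) * hdiv n - (P n /ₘ (X - C w)) * hdiv k
    rw [e, map_add, map_sub, map_smul, map_smul,
      hP.map_mul_eq_zero (hle k (Finset.mem_range.1 hk)), smul_eq_mul, smul_eq_mul]
    ring
  have hexp := hP.expansion n _ hdeg
  rw [Finset.sum_congr rfl fun k hk => by rw [hcoef k hk]] at hexp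
  rw [← hexp, hdiv]
  ring

end IsOrthonormalFor

/-! ### Weighted coefficient sums -/

/-- The `ℓ¹` size, with weight `r ^ j`, of the first `M` coefficients of a polynomial. -/
noncomputable def coeffSum (r : ℝ) (M : ℕ) (p : ℂ[X]) : ℝ :=
  ∑ j ∈ Finset.range M, ‖p.coeff j‖ * r ^ j

section CoeffSum

variable {r : ℝ} {M : ℕ}

theorem coeffSum_nonneg (hr : 0 ≤ r) (p : ℂ[X]) : 0 ≤ coeffSum r M p :=
  Finset.sum_nonneg fun _ _ => by positivity

theorem coeffSum_add_le (hr : 0 ≤ r) (p q : ℂ[X]) :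
    coeffSum r M (p + q) ≤ coeffSum r M p + coeffSum r M q := by
  rw [coeffSum, coeffSum, coeffSum, ← Finset.sum_add_distrib]
  refine Finset.sum_le_sum fun j _ => ?_
  rw [coeff_add, ← add_mul]
  exact mul_le_mul_of_nonneg_right (norm_add_le _ _) (by positivity)

theorem coeffSum_sum_le (hr : 0 ≤ r) {ι : Type*} (s : Finset ι) (f : ι → ℂ[X]) :
    coeffSum r M (∑ i ∈ s, f i) ≤ ∑ i ∈ s, coeffSum r M (f i) := by
  classical
  induction s using Finset.induction_on with
  | empty => simp [coeffSum]
  | insert a s ha ih =>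
    rw [Finset.sum_insert ha, Finset.sum_insert ha]
    exact (coeffSum_add_le hr _ _).trans (by gcongr)

theorem coeffSum_C_mul (c : ℂ) (p : ℂ[X]) : coeffSum r M (C c * p) = ‖c‖ * coeffSum r M p := by
  simp only [coeffSum, coeff_C_mul, norm_mul, Finset.mul_sum, mul_assoc]

theorem coeffSum_C_le (c : ℂ) : coeffSum r M (C c) ≤ ‖c‖ := by
  rcases M with _ | M
  · simp [coeffSum]
  · rw [coeffSum, Finset.sum_range_succ']
    simp [coeff_C]

theorem coeffSum_X_mul_le (hr : 0 ≤ r) (p : ℂ[X]) :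
    coeffSum r M (X * p) ≤ r * coeffSum r M p := by
  rcases M with _ | M
  · simp [coeffSum]
  · rw [coeffSum, Finset.sum_range_succ', coeffSum, Finset.mul_sum, Finset.sum_range_succ]
    simp only [coeff_X_mul, coeff_X_mul_zero, norm_zero, zero_mul, add_zero]
    have : 0 ≤ r * (‖p.coeff M‖ * r ^ M) := by positivity
    refine le_add_of_le_of_nonneg (Finset.sum_le_sum fun j _ => le_of_eq ?_) this
    ring

theorem coeffSum_X_sub_C_mul_le (hr : 0 ≤ r) (w : ℂ) (p : ℂ[X]) :
    coeffSum r M ((X - C w) * p) ≤ (r + ‖w‖) * coeffSum r M p := by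
  have e : (X - C w) * p = X * p + C (-w) * p := by
    rw [C_neg]; ring
  rw [e]
  refine (coeffSum_add_le hr _ _).trans ?_
  rw [coeffSum_C_mul, norm_neg, add_mul]
  gcongr
  exact coeffSum_X_mul_le hr p

end CoeffSum

/-! ### Gronwall inequality and growth of the coefficients -/

theorem prod_one_add_eq_one_add_sum (f : ℕ → ℝ) (n : ℕ) :
    ∏ k ∈ Finset.range n, (1 + f k) =
      1 + ∑ k ∈ Finset.range n, f k * ∏ j ∈ Finset.range k, (1 + f j) := by
  induction n with
  | zero => simp
  | succ n ih =>
    rw [Finset.prod_range_succ, Finset.sum_range_succ, mul_one_add, ← add_assoc, ← ih]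
    ring

/-- A discrete Gronwall inequality. -/
theorem le_mul_prod_of_le_add_sum {u h : ℕ → ℝ} {ρ : ℝ} (hh : ∀ n, 0 ≤ h n) (hρ : 0 ≤ ρ)
    (hu : ∀ n, u n ≤ h n + ρ * ∑ k ∈ Finset.range n, h n * h k * u k) (n : ℕ) :
    u n ≤ h n * ∏ k ∈ Finset.range n, (1 + ρ * h k ^ 2) := by
  induction n using Nat.strong_induction_on with
  | _ n ih =>
    refine (hu n).trans ?_
    -- The claimed bound solves the recursion with equality, so the two sums can be compared term by
    -- term.
    rw [prod_one_add_eq_one_add_sum, mul_add, mul_one, Finset.mul_sum, Finset.mul_sum]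
    refine add_le_add le_rfl (Finset.sum_le_sum fun k hk => ?_)
    calc ρ * (h n * h k * u k)
        ≤ ρ * (h n * h k * (h k * ∏ k ∈ Finset.range k, (1 + ρ * h k ^ 2))) := by
          have := hh n
          have := hh k
          gcongr
          exact ih k (Finset.mem_range.1 hk)
      _ = _ := by ring

/-- The infinite product attached to a summable sequence is of minimal exponential type. -/
theorem exists_prod_one_add_mul_le_exp {a : ℕ → ℝ} (ha : ∀ n, 0 ≤ a n) (hs : Summable a)
    {ε : ℝ} (hε : 0 < ε) :
    ∃ K : ℝ, 0 < K ∧ ∀ ρ : ℝ, 0 ≤ ρ → ∀ n : ℕ,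
      ∏ k ∈ Finset.range n, (1 + ρ * a k) ≤ K * Real.exp (ε * ρ) := by
  obtain ⟨m, hm⟩ : ∃ m, ∑' k, a (k + m) < ε / 2 :=
    ((tendsto_order.1 (tendsto_sum_nat_add a)).2 (ε / 2) (by positivity)).exists
  obtain ⟨δ, hδ, hδm⟩ : ∃ δ : ℝ, 0 < δ ∧ m * δ ≤ ε / 2 := by
    refine ⟨ε / 2 / (m + 1), by positivity, ?_⟩
    rw [mul_div_assoc', div_le_iff₀ (by positivity)]
    nlinarith
  refine ⟨∏ k ∈ Finset.range m, (1 + a k / δ), Finset.prod_pos fun k _ => ?_, fun ρ hρ n => ?_⟩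
  · have := ha k
    positivity
  -- Each of the first m factors is at most (1 + a_k/δ)(1 + δρ) ≤ (1 + a_k/δ) e^{δρ}. The
  -- exponentials contribute at most e^{ερ/2} since mδ ≤ ε/2; the remaining factors use 1 + x ≤ e^x
  -- and the small tail.
  have h1 : ∏ k ∈ Finset.range m, (1 + ρ * a k) ≤
      (∏ k ∈ Finset.range m, (1 + a k / δ)) * Real.exp (ε / 2 * ρ) := by
    have hexp : Real.exp (δ * ρ) ^ m ≤ Real.exp (ε / 2 * ρ) := by
      rw [← Real.exp_nat_mul, Real.exp_le_exp, ← mul_assoc]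
      gcongr
    have hp : 0 ≤ ∏ k ∈ Finset.range m, (1 + a k / δ) := Finset.prod_nonneg fun k _ => by
      have := ha k
      positivity
    refine le_trans ?_ (mul_le_mul_of_nonneg_left hexp hp)
    rw [← Finset.card_range m, ← Finset.prod_const, Finset.card_range, ← Finset.prod_mul_distrib]
    refine Finset.prod_le_prod (fun k _ => ?_) fun k _ => ?_
    · have := ha k
      positivity
    · have hk := ha k
      have h2 := Real.add_one_le_exp (δ * ρ)
      calc 1 + ρ * a k ≤ (1 + a k / δ) * (δ * ρ + 1) := by
            have e : (1 + a k / δ) * (δ * ρ + 1) = 1 + ρ * a k + (a k / δ + δ * ρ) := by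
              field_simp
              ring
            rw [e]
            have : 0 ≤ a k / δ + δ * ρ := by positivity
            linarith
        _ ≤ _ := by gcongr
  have h2 : ∏ k ∈ Finset.range n, (1 + ρ * a (k + m)) ≤ Real.exp (ε / 2 * ρ) := by
    calc ∏ k ∈ Finset.range n, (1 + ρ * a (k + m))
        ≤ ∏ k ∈ Finset.range n, Real.exp (ρ * a (k + m)) := by
          refine Finset.prod_le_prod (fun k _ => ?_) fun k _ => ?_
          · have := ha (k + m)
            positivity
          · rw [add_comm]
            exact Real.add_one_le_exp _
      _ = Real.exp (ρ * ∑ k ∈ Finset.range n, a (k + m)) := by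
          rw [← Real.exp_sum, Finset.mul_sum]
      _ ≤ _ := by
          rw [Real.exp_le_exp, mul_comm]
          gcongr
          exact (((summable_nat_add_iff m).2 hs).sum_le_tsum _ fun k _ => ha _).trans hm.le
  calc ∏ k ∈ Finset.range n, (1 + ρ * a k)
      ≤ ∏ k ∈ Finset.range (m + n), (1 + ρ * a k) := by
        refine Finset.prod_le_prod_of_subset_of_one_le (Finset.range_mono (Nat.le_add_left n m))
          (fun k _ => ?_) fun k _ _ => ?_
        · have := ha k
          positivity
        · have := mul_nonneg hρ (ha k)
          linarith
    _ = (∏ k ∈ Finset.range m, (1 + ρ * a k)) * ∏ k ∈ Finset.range n, (1 + ρ * a (k + m)) := by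
        rw [Finset.prod_range_add]
        simp only [add_comm]
    _ ≤ (∏ k ∈ Finset.range m, (1 + a k / δ)) * Real.exp (ε / 2 * ρ) * Real.exp (ε / 2 * ρ) := by
        refine mul_le_mul h1 h2 (Finset.prod_nonneg fun k _ => ?_)
          (mul_nonneg (Finset.prod_nonneg fun k _ => ?_) (Real.exp_pos _).le)
        · have := ha (k + m)
          positivity
        · have := ha k
          positivity
    _ = _ := by
        rw [mul_assoc, ← Real.exp_add, ← add_mul, add_halves]

/-- If the orthonormal polynomials and those of the second kind are square summable at one point,
the coefficients of the orthonormal polynomials are of minimal exponential type. -/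
theorem IsOrthonormalFor.exists_coeffSum_le {L : ℂ[X] →ₗ[ℂ] ℂ} {P : ℕ → ℂ[X]}
    (hP : IsOrthonormalFor L P) {w : ℂ} (h1 : Summable fun n => ‖(P n).eval w‖ ^ 2)
    (h2 : Summable fun n => ‖L (P n /ₘ (X - C w))‖ ^ 2) :
    ∃ h : ℕ → ℝ, (∀ n, 0 ≤ h n) ∧ (Summable fun n => h n ^ 2) ∧
      ∀ ε : ℝ, 0 < ε → ∃ K : ℝ, 0 < K ∧ ∀ r : ℝ, 0 ≤ r → ∀ M n : ℕ,
        coeffSum r M (P n) ≤ K * Real.exp (ε * r) * h n := by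
  -- This h_n dominates |P_n(w)|, and by Cauchy-Schwarz h_n h_k dominates the kernel of the
  -- variation of constants formula.
  obtain ⟨h, hdef⟩ : ∃ h : ℕ → ℝ,
    h = fun n => Real.sqrt (‖(P n).eval w‖ ^ 2 + ‖L (P n /ₘ (X - C w))‖ ^ 2) := ⟨_, rfl⟩
  have hsq : ∀ n, h n ^ 2 = ‖(P n).eval w‖ ^ 2 + ‖L (P n /ₘ (X - C w))‖ ^ 2 := fun n => by
    rw [hdef]
    exact Real.sq_sqrt (by positivity)
  have h0 : ∀ n, 0 ≤ h n := fun n => by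
    rw [hdef]
    exact Real.sqrt_nonneg _
  have hsum : Summable fun n => h n ^ 2 := by
    simp only [hsq]
    exact h1.add h2
  have hp : ∀ n, ‖(P n).eval w‖ ≤ h n := fun n =>
    abs_le_of_sq_le_sq' (by rw [hsq]; exact le_add_of_nonneg_right (sq_nonneg _)) (h0 n) |>.2
  have hc : ∀ n k, ‖(P k).eval w * L (P n /ₘ (X - C w)) - (P n).eval w * L (P k /ₘ (X - C w))‖
      ≤ h n * h k := by
    intro n k
    refine (norm_sub_le _ _).trans ?_
    rw [norm_mul, norm_mul]
    refine abs_le_of_sq_le_sq' ?_ (mul_nonneg (h0 n) (h0 k)) |>.2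
    rw [mul_pow, hsq, hsq]
    nlinarith [sq_nonneg (‖(P k).eval w‖ * ‖(P n).eval w‖ -
      ‖L (P n /ₘ (X - C w))‖ * ‖L (P k /ₘ (X - C w))‖)]
  refine ⟨h, h0, hsum, fun ε hε => ?_⟩
  obtain ⟨K, hK, hKb⟩ := exists_prod_one_add_mul_le_exp (fun n => sq_nonneg (h n)) hsum hε
  -- The factor e^{ε‖w‖} absorbs the shift from r to r + ‖w‖.
  refine ⟨K * Real.exp (ε * ‖w‖), by positivity, fun r hr M n => ?_⟩
  have hρ : 0 ≤ r + ‖w‖ := by positivity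
  have hrec : ∀ n, coeffSum r M (P n) ≤ h n + (r + ‖w‖) *
      ∑ k ∈ Finset.range n, h n * h k * coeffSum r M (P k) := by
    intro n
    conv_lhs => rw [hP.eq_add_mul_sum w n]
    refine (coeffSum_add_le hr _ _).trans (add_le_add ((coeffSum_C_le _).trans (hp n)) ?_)
    refine (coeffSum_X_sub_C_mul_le hr _ _).trans (mul_le_mul_of_nonneg_left ?_ hρ)
    refine (coeffSum_sum_le hr _ _).trans (Finset.sum_le_sum fun k _ => ?_)
    rw [coeffSum_C_mul]
    exact mul_le_mul_of_nonneg_right (hc n k) (coeffSum_nonneg hr _)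
  calc coeffSum r M (P n) ≤ h n * ∏ k ∈ Finset.range n, (1 + (r + ‖w‖) * h k ^ 2) :=
        le_mul_prod_of_le_add_sum h0 hρ hrec n
    _ ≤ h n * (K * Real.exp (ε * (r + ‖w‖))) := by
        have := h0 n
        gcongr
        exact hKb _ hρ n
    _ = _ := by
        rw [mul_add, Real.exp_add]
        ring

/-! ### Uniqueness for the Stieltjes transform -/

section Stieltjes

theorem integrable_inv_sub (μ : Measure ℝ) [IsFiniteMeasure μ] {w : ℂ} (hw : w.im ≠ 0) :
    Integrable (fun x : ℝ => ((x : ℂ) - w)⁻¹) μ := by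
  have hne : ∀ x : ℝ, (x : ℂ) - w ≠ 0 := fun x h => hw (by
    have := congrArg Complex.im h
    simpa using this)
  refine Integrable.of_bound
    (Continuous.inv₀ (by fun_prop) hne).aestronglyMeasurable |w.im|⁻¹ (ae_of_all _ fun x => ?_)
  rw [norm_inv]
  gcongr
  have := Complex.abs_im_le_norm ((x : ℂ) - w)
  simpa using this

/-- Stieltjes inversion: the imaginary part of the transform at t + iy is the measure smoothed by
the Poisson kernel, which recovers π μ weakly as y → 0. -/
theorem integral_poisson_eq_im (μ : Measure ℝ) [IsFiniteMeasure μ] {y : ℝ} (hy : 0 < y) (t : ℝ) :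
    ∫ x, y / ((t - x) ^ 2 + y ^ 2) ∂μ =
      (∫ x : ℝ, ((x : ℂ) - (t + y * Complex.I))⁻¹ ∂μ).im := by
  have hint := integrable_inv_sub μ (w := t + y * Complex.I) (by simpa using hy.ne')
  have := integral_im hint
  simp only [RCLike.im_to_complex] at this
  rw [← this]
  refine integral_congr_ae (ae_of_all _ fun x => ?_)
  simp only [Complex.inv_im, Complex.normSq_apply]
  simp
  congr 1
  ring

theorem integral_mul_poisson (f : BoundedContinuousFunction ℝ ℝ) {y : ℝ} (hy : 0 < y) (x : ℝ) :
    ∫ t, f t * (y / ((t - x) ^ 2 + y ^ 2)) = ∫ s, f (x + y * s) * (1 + s ^ 2)⁻¹ := by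
  rw [← integral_add_left_eq_self (fun t => f t * (y / ((t - x) ^ 2 + y ^ 2))) x]
  have := Measure.integral_comp_mul_left
    (fun t => f (x + t) * (y / ((x + t - x) ^ 2 + y ^ 2))) y
  rw [abs_of_pos (inv_pos.2 hy), smul_eq_mul, inv_mul_eq_div, eq_div_iff hy.ne'] at this
  rw [← this, ← integral_mul_const]
  refine integral_congr_ae (ae_of_all _ fun s => ?_)
  simp only [add_sub_cancel_left]
  have h1 : (1 + s ^ 2) ≠ 0 := by positivity
  have h2 : (y * s) ^ 2 + y ^ 2 ≠ 0 := by positivity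
  field_simp
  ring

theorem integrable_poisson {y : ℝ} (hy : 0 < y) :
    Integrable (fun u : ℝ => y / (u ^ 2 + y ^ 2)) := by
  have := (integrable_inv_one_add_sq.comp_mul_left' (inv_ne_zero hy.ne')).const_mul y⁻¹
  refine this.congr (ae_of_all _ fun u => ?_)
  have h2 : u ^ 2 + y ^ 2 ≠ 0 := by positivity
  have h3 : 1 + (y⁻¹ * u) ^ 2 ≠ 0 := by positivity
  simp only
  field_simp
  ring

/-- Fubini moves the smoothing from the measure to f, and t = x + y s then makes the kernel
independent of y. -/
theorem integral_integral_poisson (μ : Measure ℝ) [IsFiniteMeasure μ]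
    (f : BoundedContinuousFunction ℝ ℝ) {y : ℝ} (hy : 0 < y) :
    ∫ t, f t * ∫ x, y / ((t - x) ^ 2 + y ^ 2) ∂μ =
      ∫ x, (∫ s, f (x + y * s) * (1 + s ^ 2)⁻¹) ∂μ := by
  have h1 : Integrable (fun p : ℝ × ℝ => y / ((p.1 - p.2) ^ 2 + y ^ 2)) (volume.prod μ) := by
    have := Integrable.convolution_integrand (L := ContinuousLinearMap.mul ℝ ℝ) (μ := volume)
      (ν := μ) (integrable_const (1 : ℝ)) (integrable_poisson hy)
    simpa using this
  have h2 : Integrable (fun p : ℝ × ℝ => f p.1 * (y / ((p.1 - p.2) ^ 2 + y ^ 2)))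
      (volume.prod μ) := by
    refine h1.bdd_mul (c := ‖f‖) ?_ (ae_of_all _ fun p => f.norm_coe_le_norm p.1)
    exact (f.continuous.comp continuous_fst).aestronglyMeasurable
  have h3 := integral_integral_swap (f := fun t x => f t * (y / ((t - x) ^ 2 + y ^ 2))) h2
  simp only [integral_const_mul] at h3
  rw [h3]
  simp only [integral_mul_poisson f hy]

/-- Dominated convergence, in s and then in x; π is the integral of (1 + s²)⁻¹. -/
theorem tendsto_integral_integral_poisson (μ : Measure ℝ) [IsFiniteMeasure μ]
    (f : BoundedContinuousFunction ℝ ℝ) :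
    Tendsto (fun n : ℕ => ∫ x, (∫ s, f (x + (1 / ((n : ℝ) + 1)) * s) * (1 + s ^ 2)⁻¹) ∂μ) atTop
      (𝓝 (∫ x, f x * Real.pi ∂μ)) := by
  have hb : ∀ x t s : ℝ, ‖f (x + t * s) * (1 + s ^ 2)⁻¹‖ ≤ ‖f‖ * (1 + s ^ 2)⁻¹ := by
    intro x t s
    rw [norm_mul, Real.norm_of_nonneg (by positivity : (0 : ℝ) ≤ (1 + s ^ 2)⁻¹)]
    gcongr
    exact f.norm_coe_le_norm _
  have hint : Integrable (fun s : ℝ => ‖f‖ * (1 + s ^ 2)⁻¹) :=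
    integrable_inv_one_add_sq.const_mul _
  have hinner : ∀ x : ℝ, Tendsto
      (fun n : ℕ => ∫ s, f (x + (1 / ((n : ℝ) + 1)) * s) * (1 + s ^ 2)⁻¹) atTop
      (𝓝 (f x * Real.pi)) := by
    intro x
    have e : f x * Real.pi = ∫ s : ℝ, f x * (1 + s ^ 2)⁻¹ := by
      rw [integral_const_mul, integral_univ_inv_one_add_sq]
    rw [e]
    refine tendsto_integral_of_dominated_convergence _ (fun n => ?_) hint
      (fun n => ae_of_all _ fun s => hb x _ s) (ae_of_all _ fun s => ?_)
    · refine Continuous.aestronglyMeasurable (Continuous.mul (by fun_prop) ?_)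
      exact Continuous.inv₀ (by fun_prop) fun s => by positivity
    · refine Tendsto.mul_const _ ?_
      have : Tendsto (fun n : ℕ => x + (1 / ((n : ℝ) + 1)) * s) atTop (𝓝 (x + 0 * s)) :=
        (tendsto_one_div_add_atTop_nhds_zero_nat.mul_const s).const_add x
      rw [zero_mul, add_zero] at this
      exact (f.continuous.tendsto x).comp this
  refine tendsto_integral_of_dominated_convergence (fun _ => ∫ s : ℝ, ‖f‖ * (1 + s ^ 2)⁻¹)
    (fun n => ?_) (integrable_const _) (fun n => ae_of_all _ fun x => ?_)
    (ae_of_all _ hinner)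
  · refine Continuous.aestronglyMeasurable ?_
    refine continuous_of_dominated (fun x => ?_) (fun x => ae_of_all _ fun s => hb x _ s) hint
      (ae_of_all _ fun s => by fun_prop)
    refine Continuous.aestronglyMeasurable (Continuous.mul (by fun_prop) ?_)
    exact Continuous.inv₀ (by fun_prop) fun s => by positivity
  · exact norm_integral_le_of_norm_le hint (ae_of_all _ fun s => hb x _ s)

/-- A finite measure on the line is determined by its Stieltjes transform. -/
theorem eq_of_forall_integral_inv_sub_eq {μ ν : Measure ℝ} [IsFiniteMeasure μ] [IsFiniteMeasure ν]
    (h : ∀ w : ℂ, w.im ≠ 0 → ∫ x : ℝ, ((x : ℂ) - w)⁻¹ ∂μ = ∫ x : ℝ, ((x : ℂ) - w)⁻¹ ∂ν) :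
    μ = ν := by
  refine ext_of_forall_integral_eq_of_IsFiniteMeasure fun f => ?_
  have h1 := tendsto_integral_integral_poisson μ f
  have h2 := tendsto_integral_integral_poisson ν f
  have e : ∀ n : ℕ, ∫ x, (∫ s, f (x + (1 / ((n : ℝ) + 1)) * s) * (1 + s ^ 2)⁻¹) ∂μ =
      ∫ x, (∫ s, f (x + (1 / ((n : ℝ) + 1)) * s) * (1 + s ^ 2)⁻¹) ∂ν := by
    intro n
    have hy : 0 < 1 / ((n : ℝ) + 1) := by positivity
    rw [← integral_integral_poisson μ f hy, ← integral_integral_poisson ν f hy]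
    simp only [integral_poisson_eq_im _ hy]
    refine integral_congr_ae (ae_of_all _ fun t => ?_)
    have hw := h (t + ((1 / ((n : ℝ) + 1) : ℝ) : ℂ) * Complex.I) (by
      rw [Complex.add_im, Complex.ofReal_im, Complex.im_ofReal_mul, Complex.I_im, mul_one, zero_add]
      exact hy.ne')
    simp only [hw]
  simp only [e] at h1
  have := tendsto_nhds_unique h1 h2
  rw [integral_mul_const, integral_mul_const] at this
  exact mul_right_cancel₀ Real.pi_ne_zero this

end Stieltjes

/-! ### Indeterminacy and square summable solutions -/

section Moments

/-- The linear functional on `ℂ[X]` with the moments of `μ`. -/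
noncomputable def momentFunctional (μ : Measure ℝ) : ℂ[X] →ₗ[ℂ] ℂ :=
  Polynomial.lsum fun n => (moment μ n : ℂ) • LinearMap.id

theorem HasAllMoments.isFiniteMeasure {μ : Measure ℝ} (h : HasAllMoments μ) :
    IsFiniteMeasure μ := by
  have := h 0
  simp only [pow_zero] at this
  exact (integrable_const_iff.1 this).resolve_left one_ne_zero

theorem integrable_eval_ofReal {μ : Measure ℝ} (h : HasAllMoments μ) (p : ℂ[X]) :
    Integrable (fun x : ℝ => p.eval (x : ℂ)) μ := by
  simp only [Polynomial.eval_eq_sum_range]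
  refine integrable_finsetSum _ fun i _ => Integrable.const_mul ?_ _
  have := (h i).ofReal (𝕜 := ℂ)
  simpa using this

/-- Every solution ν of the moment problem represents the same functional, so the polynomials of μ
are orthonormal for ν as well. -/
theorem momentFunctional_eq_integral {μ ν : Measure ℝ} (h : HasAllMoments ν)
    (hm : ∀ n, moment ν n = moment μ n) (p : ℂ[X]) :
    momentFunctional μ p = ∫ x : ℝ, p.eval (x : ℂ) ∂ν := by
  simp only [Polynomial.eval_eq_sum_range]
  rw [integral_finsetSum]
  · rw [momentFunctional, Polynomial.lsum_apply, Polynomial.sum_over_range _ (by simp)]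
    refine Finset.sum_congr rfl fun n _ => ?_
    rw [integral_const_mul]
    have : ∫ x : ℝ, (x : ℂ) ^ n ∂ν = (moment ν n : ℂ) := by
      rw [moment, ← integral_complex_ofReal]
      simp
    rw [this, hm]
    simp [mul_comm]
  · intro i _
    have := (h i).ofReal (𝕜 := ℂ)
    exact Integrable.const_mul (by simpa using this) _

/-- The orthonormal polynomials with their coefficients viewed as complex numbers. -/
noncomputable def complexOrthoPoly (μ : Measure ℝ) (n : ℕ) : ℂ[X] :=
  (orthoPoly μ n).map (algebraMap ℝ ℂ)

theorem eval_complexOrthoPoly_ofReal (μ : Measure ℝ) (n : ℕ) (x : ℝ) :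
    (complexOrthoPoly μ n).eval (x : ℂ) = ((orthoPoly μ n).eval x : ℝ) := by
  rw [complexOrthoPoly, eval_map]
  exact eval₂_at_apply (algebraMap ℝ ℂ) x

theorem isOrthonormalFor_complexOrthoPoly {μ : Measure ℝ} (h : HasAllMoments μ)
    (hs : μ.support.Infinite) :
    IsOrthonormalFor (momentFunctional μ) (complexOrthoPoly μ) where
  degree_eq n := by
    rw [complexOrthoPoly, degree_map]
    exact ((orthoPoly_isOrthonormalPolynomials h hs).1 n).1
  orthonormal m n := by
    rw [momentFunctional_eq_integral h fun _ => rfl]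
    simp only [eval_mul, eval_complexOrthoPoly_ofReal, ← Complex.ofReal_mul]
    rw [integral_complex_ofReal, (orthoPoly_isOrthonormalPolynomials h hs).2]
    split_ifs <;> simp

/-- Bessel's inequality for polynomials which are orthonormal in `L²(ν)`. -/
theorem sum_sq_integral_mul_le {ν : Measure ℝ} (h : HasAllMoments ν) {P : ℕ → ℝ[X]}
    (hP : ∀ m n, ∫ x, (P m).eval x * (P n).eval x ∂ν = if m = n then 1 else 0)
    {g : ℝ → ℝ} (hg : Continuous g) {c : ℝ} (hc : ∀ x, ‖g x‖ ≤ c) (N : ℕ) :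
    ∑ n ∈ Finset.range N, (∫ x, g x * (P n).eval x ∂ν) ^ 2 ≤ ∫ x, g x ^ 2 ∂ν := by
  have := h.isFiniteMeasure
  have hgp : ∀ p : ℝ[X], Integrable (fun x => g x * p.eval x) ν := fun p =>
    (integrable_eval h p).bdd_mul hg.aestronglyMeasurable (ae_of_all _ hc)
  have hgg : Integrable (fun x => g x ^ 2) ν := by
    simp only [pow_two]
    exact (Integrable.of_bound hg.aestronglyMeasurable c (ae_of_all _ hc)).bdd_mul
      hg.aestronglyMeasurable (ae_of_all _ hc)
  obtain ⟨a, ha⟩ : ∃ a : ℕ → ℝ, a = fun n => ∫ x, g x * (P n).eval x ∂ν := ⟨_, rfl⟩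
  obtain ⟨S, hS⟩ : ∃ S : ℝ[X], S = ∑ n ∈ Finset.range N, C (a n) * P n := ⟨_, rfl⟩
  have hgS : ∫ x, g x * S.eval x ∂ν = ∑ n ∈ Finset.range N, a n ^ 2 := by
    have e : ∀ x, g x * S.eval x = ∑ n ∈ Finset.range N, a n * (g x * (P n).eval x) := by
      intro x
      simp only [hS, eval_finsetSum, eval_mul, eval_C, Finset.mul_sum]
      exact Finset.sum_congr rfl fun n _ => by ring
    simp only [e]
    rw [integral_finsetSum _ fun n _ => (hgp _).const_mul _]
    refine Finset.sum_congr rfl fun n _ => ?_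
    rw [integral_const_mul, pow_two, ha]
  have hPS : ∀ m ∈ Finset.range N, ∫ x, (P m).eval x * S.eval x ∂ν = a m := by
    intro m hm
    have e : ∀ x, (P m).eval x * S.eval x =
        ∑ n ∈ Finset.range N, a n * ((P m).eval x * (P n).eval x) := by
      intro x
      simp only [hS, eval_finsetSum, eval_mul, eval_C, Finset.mul_sum]
      exact Finset.sum_congr rfl fun n _ => by ring
    simp only [e]
    rw [integral_finsetSum _ fun n _ => (integrable_eval_mul h _ _).const_mul _]
    simp only [integral_const_mul, hP]
    simpa using fun hh : N ≤ m => absurd (Finset.mem_range.1 hm) hh.not_gt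
  have hSS : ∫ x, S.eval x * S.eval x ∂ν = ∑ n ∈ Finset.range N, a n ^ 2 := by
    have e : ∀ x, S.eval x * S.eval x =
        ∑ n ∈ Finset.range N, a n * ((P n).eval x * S.eval x) := by
      intro x
      have hSx : S.eval x = ∑ n ∈ Finset.range N, a n * (P n).eval x := by
        simp only [hS, eval_finsetSum, eval_mul, eval_C]
      simp only [← mul_assoc, ← Finset.sum_mul, ← hSx]
    simp only [e]
    rw [integral_finsetSum _ fun n _ => (integrable_eval_mul h _ _).const_mul _]
    refine Finset.sum_congr rfl fun n hn => ?_
    rw [integral_const_mul, hPS n hn, pow_two]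
  -- With S the partial Fourier sum of g, ∫ (g - S)² = ∫ g² - ∑ a_n².
  have h0 : 0 ≤ ∫ x, (g x - S.eval x) ^ 2 ∂ν := integral_nonneg fun x => sq_nonneg _
  have e : ∀ x, (g x - S.eval x) ^ 2 = g x ^ 2 - 2 * (g x * S.eval x) + S.eval x * S.eval x :=
    fun x => by ring
  simp only [e] at h0
  have hsub : Integrable (fun x => g x ^ 2 - 2 * (g x * S.eval x)) ν :=
    hgg.sub ((hgp S).const_mul 2)
  rw [integral_add hsub (integrable_eval_mul h S S), integral_sub hgg ((hgp S).const_mul 2), integral_const_mul, hgS, hSS] at h0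
  have : ∑ n ∈ Finset.range N, (∫ x, g x * (P n).eval x ∂ν) ^ 2 =
      ∑ n ∈ Finset.range N, a n ^ 2 := by rw [ha]
  linarith

theorem summable_sq_integral_mul {ν : Measure ℝ} (h : HasAllMoments ν) {P : ℕ → ℝ[X]}
    (hP : ∀ m n, ∫ x, (P m).eval x * (P n).eval x ∂ν = if m = n then 1 else 0)
    {g : ℝ → ℝ} (hg : Continuous g) {c : ℝ} (hc : ∀ x, ‖g x‖ ≤ c) :
    Summable fun n => (∫ x, g x * (P n).eval x ∂ν) ^ 2 :=
  summable_of_sum_range_le (fun _ => sq_nonneg _) fun N => sum_sq_integral_mul_le h hP hg hc N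

/-- Weyl's square summable solution attached to a solution `ν` of the moment problem. -/
theorem summable_sq_norm_second_kind_add {μ ν : Measure ℝ} (h : HasAllMoments μ)
    (hs : μ.support.Infinite) (hν : HasAllMoments ν) (hm : ∀ n, moment ν n = moment μ n)
    {w : ℂ} (hw : w.im ≠ 0) :
    Summable fun n => ‖momentFunctional μ (complexOrthoPoly μ n /ₘ (X - C w)) +
      (∫ x : ℝ, ((x : ℂ) - w)⁻¹ ∂ν) * (complexOrthoPoly μ n).eval w‖ ^ 2 := by
  have := hν.isFiniteMeasure
  have hne : ∀ x : ℝ, (x : ℂ) - w ≠ 0 := fun x h => hw (by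
    have := congrArg Complex.im h
    simpa using this)
  have hcont : Continuous fun x : ℝ => ((x : ℂ) - w)⁻¹ := Continuous.inv₀ (by fun_prop) hne
  have hbound : ∀ x : ℝ, ‖((x : ℂ) - w)⁻¹‖ ≤ |w.im|⁻¹ := by
    intro x
    rw [norm_inv]
    gcongr
    have := Complex.abs_im_le_norm ((x : ℂ) - w)
    simpa using this
  have horth : ∀ m n, ∫ x, (orthoPoly μ m).eval x * (orthoPoly μ n).eval x ∂ν =
      if m = n then 1 else 0 := by
    intro m n
    have h1 := (isOrthonormalFor_complexOrthoPoly h hs).orthonormal m n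
    rw [momentFunctional_eq_integral hν hm] at h1
    simp only [eval_mul, eval_complexOrthoPoly_ofReal, ← Complex.ofReal_mul] at h1
    rw [integral_complex_ofReal] at h1
    split_ifs at h1 ⊢ <;> exact_mod_cast h1
  have hre := summable_sq_integral_mul hν horth (Complex.continuous_re.comp hcont)
    fun x => (Complex.abs_re_le_norm _).trans (hbound x)
  have him := summable_sq_integral_mul hν horth (Complex.continuous_im.comp hcont)
    fun x => (Complex.abs_im_le_norm _).trans (hbound x)
  refine (hre.add him).congr fun n => ?_
  have hint : Integrable (fun x : ℝ => ((x : ℂ) - w)⁻¹ * (complexOrthoPoly μ n).eval (x : ℂ)) ν :=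
    (integrable_eval_ofReal hν _).bdd_mul hcont.aestronglyMeasurable (ae_of_all _ hbound)
  -- The quotient takes the value (P_n(x) - P_n(w)) / (x - w) at x, so adding the transform times
  -- P_n(w) leaves the Fourier coefficient of 1 / (x - w) in L²(ν).
  have e : momentFunctional μ (complexOrthoPoly μ n /ₘ (X - C w)) +
      (∫ x : ℝ, ((x : ℂ) - w)⁻¹ ∂ν) * (complexOrthoPoly μ n).eval w =
      ∫ x : ℝ, ((x : ℂ) - w)⁻¹ * (complexOrthoPoly μ n).eval (x : ℂ) ∂ν := by
    rw [momentFunctional_eq_integral hν hm, ← integral_mul_const, ← integral_add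
      (integrable_eval_ofReal hν _) ((integrable_inv_sub ν hw).mul_const _)]
    refine integral_congr_ae (ae_of_all _ fun x => ?_)
    have hd := congrArg (eval (x : ℂ)) (modByMonic_add_div (complexOrthoPoly μ n) (X - C w))
    rw [modByMonic_X_sub_C_eq_C_eval] at hd
    simp only [eval_add, eval_mul, eval_sub, eval_X, eval_C] at hd
    simp only
    rw [← hd]
    have := hne x
    field_simp
    ring
  have hR := integral_re hint
  have hI := integral_im hint
  simp only [RCLike.re_to_complex, RCLike.im_to_complex, eval_complexOrthoPoly_ofReal,
    Complex.re_mul_ofReal, Complex.im_mul_ofReal] at hR hI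
  rw [e, ← Complex.normSq_eq_norm_sq, Complex.normSq_apply]
  simp only [eval_complexOrthoPoly_ofReal]
  rw [← hR, ← hI, pow_two, pow_two]
  rfl

/-- In the indeterminate case the coefficients of the orthonormal polynomials are of minimal
exponential type. -/
theorem IsIndeterminate.exists_coeffSum_le {μ : Measure ℝ} (hind : IsIndeterminate μ)
    (h : HasAllMoments μ) (hs : μ.support.Infinite) :
    ∃ h : ℕ → ℝ, (∀ n, 0 ≤ h n) ∧ (Summable fun n => h n ^ 2) ∧
      ∀ ε : ℝ, 0 < ε → ∃ K : ℝ, 0 < K ∧ ∀ r : ℝ, 0 ≤ r → ∀ M n : ℕ,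
        coeffSum r M (complexOrthoPoly μ n) ≤ K * Real.exp (ε * r) * h n := by
  obtain ⟨ν, hne, hν, hm⟩ := hind
  have := h.isFiniteMeasure
  have := hν.isFiniteMeasure
  obtain ⟨w, hw, hmw⟩ : ∃ w : ℂ, w.im ≠ 0 ∧
      ∫ x : ℝ, ((x : ℂ) - w)⁻¹ ∂ν ≠ ∫ x : ℝ, ((x : ℂ) - w)⁻¹ ∂μ := by
    by_contra! hcon
    exact hne (eq_of_forall_integral_inv_sub_eq hcon)
  have s1 := summable_sq_norm_second_kind_add h hs hν hm hw
  have s2 := summable_sq_norm_second_kind_add h hs h (fun _ => rfl) hw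
  have sq_sub_le : ∀ a b : ℂ, ‖a - b‖ ^ 2 ≤ 2 * ‖a‖ ^ 2 + 2 * ‖b‖ ^ 2 := by
    intro a b
    have h1 := norm_sub_le a b
    nlinarith [sq_nonneg (‖a‖ - ‖b‖), norm_nonneg (a - b), norm_nonneg a, norm_nonneg b]
  -- The square summable solutions of ν and μ differ by d P_n(w) with d ≠ 0. So P_n(w) is square
  -- summable, and then so is the second kind sequence.
  obtain ⟨d, hd⟩ : ∃ d, d = ∫ x : ℝ, ((x : ℂ) - w)⁻¹ ∂ν - ∫ x : ℝ, ((x : ℂ) - w)⁻¹ ∂μ := ⟨_, rfl⟩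
  have hd0 : 0 < ‖d‖ := norm_pos_iff.2 (by rw [hd]; exact sub_ne_zero.2 hmw)
  have sp : Summable fun n => ‖(complexOrthoPoly μ n).eval w‖ ^ 2 := by
    have hs' := ((s1.mul_left 2).add (s2.mul_left 2)).mul_left (‖d‖ ^ 2)⁻¹
    refine hs'.of_nonneg_of_le (fun n => sq_nonneg _) fun n => ?_
    rw [inv_mul_eq_div, le_div_iff₀ (by positivity), ← mul_pow, ← norm_mul]
    refine le_trans (le_of_eq ?_) (sq_sub_le _ _)
    congr 2
    rw [hd]
    ring
  refine (isOrthonormalFor_complexOrthoPoly h hs).exists_coeffSum_le sp ?_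
  have hs' := (s2.mul_left 2).add ((sp.mul_left (‖∫ x : ℝ, ((x : ℂ) - w)⁻¹ ∂μ‖ ^ 2)).mul_left 2)
  refine hs'.of_nonneg_of_le (fun n => sq_nonneg _) fun n => ?_
  rw [← mul_pow, ← norm_mul]
  refine le_trans (le_of_eq ?_) (sq_sub_le _ _)
  congr 2
  ring

end Moments

/-! ### Operators on ℓ² with summable columns -/

/-- The standard orthonormal basis of `ℓ²`. -/
noncomputable def unitVec (k : ℕ) : EllTwo := lp.single 2 k (1 : ℂ)

theorem inner_unitVec (k : ℕ) (v : EllTwo) : inner ℂ (unitVec k) v = v k := by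
  rw [unitVec, lp.inner_single_left]
  simp

theorem norm_unitVec (k : ℕ) : ‖unitVec k‖ = 1 := by
  rw [unitVec, lp.norm_single (by norm_num), norm_one]

theorem orthonormal_unitVec : Orthonormal ℂ unitVec := by
  refine ⟨norm_unitVec, fun i j hij => ?_⟩
  simp only [inner_unitVec]
  rw [unitVec, lp.single_apply_ne _ _ _ hij]

theorem isCompactOperator_rankOne (x y : EllTwo) :
    IsCompactOperator (InnerProductSpace.rankOne ℂ x y) := by
  have h : IsCompactOperator (innerSL ℂ y : EllTwo →L[ℂ] ℂ) :=
    isCompactOperator_of_locallyCompactSpace_dom _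
  rw [InnerProductSpace.rankOne_def']
  exact h.clm_comp (ContinuousLinearMap.toSpanSingleton ℂ x)

/-- The operator on `ℓ²` with columns `r k`. -/
noncomputable def columnOperator (r : ℕ → EllTwo) : EllTwo →L[ℂ] EllTwo :=
  ∑' k, InnerProductSpace.rankOne ℂ (r k) (unitVec k)

section ColumnOperator

variable {r : ℕ → EllTwo}

theorem summable_rankOne (hr : Summable fun k => ‖r k‖) :
    Summable fun k => InnerProductSpace.rankOne ℂ (r k) (unitVec k) := by
  refine Summable.of_norm ?_
  simpa [norm_unitVec] using hr

theorem isCompactOperator_columnOperator (hr : Summable fun k => ‖r k‖) :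
    IsCompactOperator (columnOperator r) := by
  refine isCompactOperator_of_tendsto (summable_rankOne hr).hasSum.tendsto_sum_nat
    (Eventually.of_forall fun n => ?_)
  exact Submodule.sum_mem (compactOperator (RingHom.id ℂ) EllTwo EllTwo)
    fun k _ => isCompactOperator_rankOne _ _

theorem hasSum_columnOperator_apply (hr : Summable fun k => ‖r k‖) (v : EllTwo) :
    HasSum (fun k => v k • r k) (columnOperator r v) := by
  have := (summable_rankOne hr).hasSum.mapL (ContinuousLinearMap.apply ℂ EllTwo v)
  simp only [ContinuousLinearMap.apply_apply, InnerProductSpace.rankOne_apply,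
    inner_unitVec] at this
  exact this

theorem columnOperator_unitVec (hr : Summable fun k => ‖r k‖) (k : ℕ) :
    columnOperator r (unitVec k) = r k := by
  refine (hasSum_columnOperator_apply hr _).unique ?_
  have h1 : r k = unitVec k k • r k := by
    rw [unitVec, lp.single_apply_self, one_smul]
  conv => arg 2; rw [h1]
  refine hasSum_single (f := fun j => unitVec k j • r j) k fun j hj => ?_
  rw [unitVec, lp.single_apply_ne _ _ _ hj, zero_smul]

/-- Only the columns from n on contribute, and each coordinate of a unit vector has modulus at most
1. -/
theorem norm_columnOperator_apply_le (hr : Summable fun k => ‖r k‖) {n : ℕ} {v : EllTwo}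
    (hv : ∀ k < n, v k = 0) (hv1 : ‖v‖ = 1) :
    ‖columnOperator r v‖ ≤ ∑' k, ‖r (k + n)‖ := by
  have h1 := hasSum_columnOperator_apply hr v
  have h2 : HasSum (fun k => v (k + n) • r (k + n)) (columnOperator r v) := by
    refine (hasSum_nat_add_iff (f := fun k => v k • r k) n).2 ?_
    rw [Finset.sum_eq_zero fun k hk => by rw [hv k (Finset.mem_range.1 hk), zero_smul], add_zero]
    exact h1
  rw [← h2.tsum_eq]
  have hs := (summable_nat_add_iff n).2 hr
  refine tsum_of_norm_bounded hs.hasSum fun k => ?_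
  rw [norm_smul]
  refine mul_le_of_le_one_left (norm_nonneg _) ?_
  rw [← hv1]
  exact lp.norm_apply_le_norm (by norm_num) v _

end ColumnOperator

/-! ### Rows of minimal exponential type and their tails -/

/-- Norms of minimal exponential type, as for the Taylor coefficients of an entire function of
minimal exponential type. -/
def IsMinimalType (r : ℕ → EllTwo) : Prop :=
  ∀ ε : ℝ, 0 < ε → ∃ K : ℝ, 0 < K ∧ ∀ ρ : ℝ, 0 ≤ ρ → ∀ k, ‖r k‖ * ρ ^ k ≤ K * Real.exp (ε * ρ)

/-- The rows of the coefficient matrix of a sequence of polynomials of minimal exponential type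
are square summable, with norms of minimal exponential type. -/
theorem exists_rows {P : ℕ → ℂ[X]} {h : ℕ → ℝ} (h0 : ∀ n, 0 ≤ h n) (hs : Summable fun n => h n ^ 2)
    (hP : ∀ ε : ℝ, 0 < ε → ∃ K : ℝ, 0 < K ∧ ∀ r : ℝ, 0 ≤ r → ∀ M n : ℕ,
        coeffSum r M (P n) ≤ K * Real.exp (ε * r) * h n) :
    ∃ r : ℕ → EllTwo, (∀ k n, r k n = (P n).coeff k) ∧ IsMinimalType r := by
  have hcoef : ∀ ε : ℝ, 0 < ε → ∃ K : ℝ, 0 < K ∧ ∀ ρ : ℝ, 0 ≤ ρ → ∀ k n,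
      ‖(P n).coeff k‖ * ρ ^ k ≤ K * Real.exp (ε * ρ) * h n := by
    intro ε hε
    obtain ⟨K, hK, hb⟩ := hP ε hε
    refine ⟨K, hK, fun ρ hρ k n => le_trans ?_ (hb ρ hρ (k + 1) n)⟩
    exact Finset.single_le_sum (f := fun j => ‖(P n).coeff j‖ * ρ ^ j)
      (fun j _ => by positivity) (Finset.self_mem_range_succ k)
  have hmem : ∀ k, Memℓp (fun n => (P n).coeff k) 2 := by
    intro k
    obtain ⟨K, hK, hb⟩ := hcoef 1 one_pos
    refine memℓp_gen ?_
    simp only [ENNReal.toReal_ofNat, Real.rpow_ofNat]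
    refine (hs.mul_left ((K * Real.exp (1 * 1)) ^ 2)).of_nonneg_of_le (fun n => by positivity)
      fun n => ?_
    rw [← mul_pow]
    have := hb 1 zero_le_one k n
    rw [one_pow, mul_one] at this
    gcongr
  have hmemh : Memℓp (fun n => (h n : ℂ)) 2 := by
    refine memℓp_gen ?_
    simpa using hs
  have hex : ∀ k, ∃ R : EllTwo, ∀ n, R n = (P n).coeff k := fun k => ⟨⟨_, hmem k⟩, fun _ => rfl⟩
  choose R hR using hex
  refine ⟨R, hR, fun ε hε => ?_⟩
  obtain ⟨H, hH⟩ : ∃ H : EllTwo, ∀ n, H n = (h n : ℂ) := ⟨⟨_, hmemh⟩, fun _ => rfl⟩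
  obtain ⟨K, hK, hb⟩ := hcoef ε hε
  refine ⟨K * (‖H‖ + 1), by positivity, fun ρ hρ k => ?_⟩
  have hE : 0 ≤ K * Real.exp (ε * ρ) := by positivity
  -- The coefficient bound carries the factor h_n, so each scaled row is dominated coordinatewise by
  -- a multiple of one fixed vector of ℓ².
  have h1 : ‖((ρ ^ k : ℝ) : ℂ) • R k‖ ≤ ‖((K * Real.exp (ε * ρ) : ℝ) : ℂ) • H‖ := by
    refine lp.norm_mono (by norm_num) fun n => ?_
    rw [lp.coeFn_smul, lp.coeFn_smul, Pi.smul_apply, Pi.smul_apply, hR k, hH, norm_smul, norm_smul,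
      Complex.norm_of_nonneg (by positivity), Complex.norm_of_nonneg hE,
      Complex.norm_of_nonneg (h0 n), mul_comm]
    exact hb ρ hρ k n
  rw [norm_smul, norm_smul, Complex.norm_of_nonneg (by positivity),
    Complex.norm_of_nonneg hE] at h1
  calc ‖R k‖ * ρ ^ k = ρ ^ k * ‖R k‖ := mul_comm _ _
    _ ≤ K * Real.exp (ε * ρ) * ‖H‖ := h1
    _ ≤ K * Real.exp (ε * ρ) * (‖H‖ + 1) := by gcongr; linarith
    _ = _ := by ring

namespace IsMinimalType

variable {r : ℕ → EllTwo}

theorem summable_norm_mul_pow (hr : IsMinimalType r) {x : ℝ} (hx : 0 ≤ x) :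
    Summable fun k => ‖r k‖ * x ^ k := by
  obtain ⟨K, hK, hb⟩ := hr 1 one_pos
  -- The bound at radius 2x leaves a geometric factor 2⁻ᵏ.
  refine ((summable_geometric_of_lt_one (by norm_num) (one_half_lt_one (α := ℝ))).mul_left
    (K * Real.exp (1 * (2 * x)))).of_nonneg_of_le (fun k => by positivity) fun k => ?_
  have := hb (2 * x) (by positivity) k
  rw [one_div, inv_pow, ← div_eq_mul_inv, le_div_iff₀ (by positivity)]
  rw [mul_pow] at this
  linarith

theorem summable_norm (hr : IsMinimalType r) : Summable fun k => ‖r k‖ := by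
  simpa using hr.summable_norm_mul_pow zero_le_one

/-- The tails `τ n` of the series of norms satisfy `n τ n ^ (1 / n) → 0`. -/
theorem tendsto_mul_tail_rpow (hr : IsMinimalType r) :
    Tendsto (fun n : ℕ => (n : ℝ) * (∑' k, ‖r (k + n)‖) ^ (1 / (n : ℝ))) atTop (𝓝 0) := by
  have hnn : ∀ n : ℕ, 0 ≤ (n : ℝ) * (∑' k, ‖r (k + n)‖) ^ (1 / (n : ℝ)) := fun n =>
    mul_nonneg n.cast_nonneg (Real.rpow_nonneg (tsum_nonneg fun _ => norm_nonneg _) _)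
  rw [tendsto_order]
  refine ⟨fun a ha => Eventually.of_forall fun n => ha.trans_le (hnn n), fun a ha => ?_⟩
  obtain ⟨ε, hε, hεa⟩ : ∃ ε : ℝ, 0 < ε ∧ Real.exp 1 * ε < a / 2 :=
    ⟨a / 4 / Real.exp 1, by positivity, by field_simp; norm_num⟩
  obtain ⟨K, hK, hb⟩ := hr ε hε
  have hlim : Tendsto (fun n : ℕ => (2 * K) ^ (1 / (n : ℝ))) atTop (𝓝 1) := by
    have := (tendsto_const_nhds (x := 2 * K)).rpow tendsto_one_div_atTop_nhds_zero_nat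
      (Or.inl (by positivity))
    simpa using this
  filter_upwards [(tendsto_order.1 hlim).2 2 (by norm_num), eventually_ge_atTop 1,
    (tendsto_natCast_atTop_atTop (R := ℝ)).eventually_ge_atTop (2 * ε)] with n hn2 hn1 hnε
  have hn0 : (0 : ℝ) < n := by exact_mod_cast hn1
  -- At ρ = n/ε the bound e^{ερ} ρ⁻ⁿ becomes (eε/n)ⁿ. Since ρ ≥ 2, the later terms are dominated by
  -- a geometric series of sum 2, and the factor (2K)^{1/n} is eventually below 2.
  obtain ⟨ρ, hρ⟩ : ∃ ρ : ℝ, ρ = n / ε := ⟨_, rfl⟩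
  have hρ2 : 2 ≤ ρ := by rw [hρ, le_div_iff₀ hε]; exact hnε
  have hερ : ε * ρ = n := by rw [hρ]; field_simp
  have hterm : ∀ k, ‖r (k + n)‖ ≤ K * Real.exp n * (ρ ^ n)⁻¹ * (1 / 2) ^ k := by
    intro k
    have h1 := hb ρ (by positivity) (k + n)
    rw [hερ, pow_add] at h1
    have h2 : (2 : ℝ) ^ k ≤ ρ ^ k := by gcongr
    rw [one_div, inv_pow, ← div_eq_mul_inv, ← div_eq_mul_inv, le_div_iff₀ (by positivity),
      le_div_iff₀ (by positivity)]
    refine le_trans ?_ h1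
    rw [mul_assoc]
    gcongr
  have htail : ∑' k, ‖r (k + n)‖ ≤ 2 * K * (Real.exp 1 * ε / n) ^ n := by
    have hs := (summable_geometric_of_lt_one (by norm_num) (one_half_lt_one (α := ℝ))).mul_left
      (K * Real.exp n * (ρ ^ n)⁻¹)
    refine (((summable_nat_add_iff n).2 hr.summable_norm).tsum_le_tsum hterm hs).trans
      (le_of_eq ?_)
    rw [tsum_mul_left, tsum_geometric_two, hρ, div_pow, div_pow, mul_pow, ← Real.exp_nat_mul,
      mul_one, inv_div]
    ring
  calc (n : ℝ) * (∑' k, ‖r (k + n)‖) ^ (1 / (n : ℝ))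
      ≤ n * (2 * K * (Real.exp 1 * ε / n) ^ n) ^ (1 / (n : ℝ)) := by
        gcongr
    _ = (2 * K) ^ (1 / (n : ℝ)) * (Real.exp 1 * ε) := by
        rw [Real.mul_rpow (by positivity) (by positivity), one_div,
          Real.pow_rpow_inv_natCast (by positivity) (by omega)]
        field_simp
    _ < 2 * (a / 2) := by
        have : 0 < Real.exp 1 * ε := by positivity
        have : 0 < (2 * K) ^ (1 / (n : ℝ)) := by positivity
        gcongr
    _ = a := by ring

end IsMinimalType

/-! ### Identification of the operators A and B -/

theorem entry_eq_inner (T : EllTwo →L[ℂ] EllTwo) (j k : ℕ) :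
    entry T j k = inner ℂ (unitVec j) (T (unitVec k)) := by
  rw [inner_unitVec]
  rfl

theorem entry_adjoint_columnOperator {r : ℕ → EllTwo} (hr : Summable fun k => ‖r k‖) (k n : ℕ) :
    entry (ContinuousLinearMap.adjoint (columnOperator r)) k n = starRingEnd ℂ (r k n) := by
  rw [entry_eq_inner, ContinuousLinearMap.adjoint_inner_right, columnOperator_unitVec hr,
    ← inner_conj_symm, inner_unitVec]

theorem entry_adjoint_comp_columnOperator {r : ℕ → EllTwo} (hr : Summable fun k => ‖r k‖)
    (j k : ℕ) :
    entry (ContinuousLinearMap.adjoint (columnOperator r) ∘L columnOperator r) j k =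
      inner ℂ (r j) (r k) := by
  rw [entry_eq_inner, ContinuousLinearMap.comp_apply, ContinuousLinearMap.adjoint_inner_right,
    columnOperator_unitVec hr, columnOperator_unitVec hr]

/-- If the columns of `T` are the coefficient sequences of the orthonormal polynomials, `T* T` is
the operator of the coefficient matrix of the kernel. -/
theorem isOperatorA_adjoint_comp {μ : Measure ℝ} {r : ℕ → EllTwo} (hr : IsMinimalType r)
    (hcoef : ∀ k n, r k n = (((orthoPoly μ n).coeff k : ℝ) : ℂ)) :
    IsOperatorA μ (ContinuousLinearMap.adjoint (columnOperator r) ∘L columnOperator r) := by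
  have hsum : ∀ z : ℂ, Summable fun k => ‖z ^ k • r k‖ := fun z => by
    refine (hr.summable_norm_mul_pow (norm_nonneg z)).congr fun k => ?_
    rw [norm_smul, norm_pow, mul_comm]
  -- The vector φ(z) = ∑ z^k r_k has coordinates P_n(z). As the inner product is conjugate linear on
  -- the left and the P_n are real, K(z,w) = ⟨φ(z̄), φ(w)⟩, whose expansion has coefficients ⟨r_j,
  -- r_k⟩.
  obtain ⟨φ, hφ⟩ : ∃ φ : ℂ → EllTwo, φ = fun z => ∑' k, z ^ k • r k := ⟨_, rfl⟩
  have hφs : ∀ z, HasSum (fun k => z ^ k • r k) (φ z) := fun z => by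
    rw [hφ]
    exact (hsum z).of_norm.hasSum
  have hφn : ∀ z n, φ z n = aeval z (orthoPoly μ n) := by
    intro z n
    have h1 := (hφs z).mapL (lp.evalCLM ℂ (fun _ : ℕ => ℂ) 2 n)
    have h2 : HasSum (fun k => z ^ k * (((orthoPoly μ n).coeff k : ℝ) : ℂ)) (φ z n) := by
      have e : (fun k => z ^ k * (((orthoPoly μ n).coeff k : ℝ) : ℂ)) =
          fun k => lp.evalCLM ℂ (fun _ : ℕ => ℂ) 2 n (z ^ k • r k) := by
        funext k
        rw [← hcoef]
        rfl
      rw [e]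
      exact h1
    refine h2.unique ?_
    rw [aeval_eq_sum_range]
    have := hasSum_sum_of_ne_finset_zero
      (L := SummationFilter.unconditional ℕ) (f := fun k => z ^ k * (((orthoPoly μ n).coeff k : ℝ) : ℂ))
      (s := Finset.range ((orthoPoly μ n).natDegree + 1)) (fun k hk => by
        rw [coeff_eq_zero_of_natDegree_lt (by simpa using hk), Complex.ofReal_zero, mul_zero])
    convert this using 1
    refine Finset.sum_congr rfl fun k _ => ?_
    rw [Complex.real_smul, mul_comm]
  have hconj : ∀ z n, starRingEnd ℂ (φ (starRingEnd ℂ z) n) = aeval z (orthoPoly μ n) := by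
    intro z n
    rw [hφn, aeval_conj, Complex.conj_conj]
  have hinner : ∀ z w : ℂ, (fun n => inner ℂ (φ (starRingEnd ℂ z) n) (φ w n)) =
      fun n => aeval z (orthoPoly μ n) * aeval w (orthoPoly μ n) := by
    intro z w
    funext n
    rw [RCLike.inner_apply, hconj, hφn, mul_comm]
  intro z w
  refine ⟨by rw [← hinner]; exact lp.summable_inner _ _, ?_⟩
  rw [kernelK, ← hinner, ← lp.inner_eq_tsum]
  have hterm : ∀ p : ℕ × ℕ, inner ℂ ((starRingEnd ℂ z) ^ p.1 • r p.1) (w ^ p.2 • r p.2) =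
      entry (ContinuousLinearMap.adjoint (columnOperator r) ∘L columnOperator r) p.1 p.2 *
        z ^ p.1 * w ^ p.2 := by
    intro p
    rw [entry_adjoint_comp_columnOperator hr.summable_norm, inner_smul_left, inner_smul_right,
      map_pow, Complex.conj_conj]
    ring
  have hS : Summable fun p : ℕ × ℕ =>
      inner ℂ ((starRingEnd ℂ z) ^ p.1 • r p.1) (w ^ p.2 • r p.2) := by
    refine Summable.of_norm_bounded ((hsum (starRingEnd ℂ z)).mul_of_nonneg (hsum w)
      (fun _ => norm_nonneg _) fun _ => norm_nonneg _) fun p => norm_inner_le_norm _ _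
  simp only [← hterm]
  convert hS.hasSum using 1
  rw [hS.tsum_prod]
  have h1 : ∀ j, ∑' k, inner ℂ ((starRingEnd ℂ z) ^ j • r j) (w ^ k • r k) =
      inner ℂ ((starRingEnd ℂ z) ^ j • r j) (φ w) := fun j =>
    ((hφs w).mapL (innerSL ℂ ((starRingEnd ℂ z) ^ j • r j))).tsum_eq
  simp only [h1]
  have h2 := (hφs (starRingEnd ℂ z)).mapL (innerSL ℂ (φ w))
  have h3 := (Complex.hasSum_conj'.2 h2)
  refine Eq.symm (HasSum.tsum_eq ?_)
  simpa only [innerSL_apply_apply, inner_conj_symm] using h3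

/-! ### Spectral subspaces of positive compact operators -/

section Spectral

variable {E : Type*} [NormedAddCommGroup E] [InnerProductSpace ℂ E] [CompleteSpace E]

/-- The norm of a positive compact operator is an eigenvalue. -/
theorem exists_eigenvector_norm [Nontrivial E] {A : E →L[ℂ] E} (hc : IsCompactOperator A)
    (hs : (A : E →ₗ[ℂ] E).IsSymmetric) (hp : ∀ v, 0 ≤ (inner ℂ (A v) v).re) :
    ∃ e : E, ‖e‖ = 1 ∧ A e = (‖A‖ : ℂ) • e := by
  suffices h : ∃ e : E, e ≠ 0 ∧ A e = (‖A‖ : ℂ) • e by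
    obtain ⟨e, he, hAe⟩ := h
    refine ⟨((‖e‖⁻¹ : ℝ) : ℂ) • e, ?_, ?_⟩
    · rw [norm_smul, Complex.norm_of_nonneg (by positivity),
        inv_mul_cancel₀ (norm_ne_zero_iff.2 he)]
    · rw [map_smul, hAe, smul_comm]
  by_cases h0 : A = 0
  · obtain ⟨e, he⟩ := exists_ne (0 : E)
    exact ⟨e, he, by simp [h0]⟩
  have hne : (‖A‖ : ℂ) ≠ 0 := by simpa using h0
  -- Otherwise the Rayleigh quotients stay below ‖A‖ - ε. Being nonnegative, they are bounded in
  -- absolute value too, which contradicts that their supremum is ‖A‖.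
  have hspec : (‖A‖ : ℂ) ∈ spectrum ℂ A := by
    by_contra hres
    obtain ⟨ε, hε, hle⟩ := A.rayleighQuotient_le_of_norm_mem_resolventSet
      (not_not.1 fun h => hres h)
    have habs : ∀ x, |A.rayleighQuotient x| ≤ ‖A‖ - ε := fun x => by
      rw [abs_of_nonneg]
      · exact hle x
      · exact div_nonneg (hp x) (sq_nonneg _)
    have := A.norm_eq_iSup_rayleighQuotient hs
    have := ciSup_le habs
    linarith
  obtain ⟨e, he⟩ := ((hc.hasEigenvalue_iff_mem_spectrum hne).2 hspec).exists_hasEigenvector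
  exact ⟨e, he.2, Module.End.mem_eigenspace_iff.1 he.1⟩

/-- By symmetry Vᗮ is invariant as well, and it is nonzero because E is infinite dimensional; M is
the norm of the restriction to it. -/
theorem exists_eigenvector_orthogonal {A : E →L[ℂ] E} (hc : IsCompactOperator A)
    (hs : (A : E →ₗ[ℂ] E).IsSymmetric) (hp : ∀ v, 0 ≤ (inner ℂ (A v) v).re)
    (hE : ¬ FiniteDimensional ℂ E) {V : Submodule ℂ E} [FiniteDimensional ℂ V]
    (hV : ∀ v ∈ V, A v ∈ V) :
    ∃ M : ℝ, 0 ≤ M ∧ (∀ v ∈ Vᗮ, ‖A v‖ ≤ M * ‖v‖) ∧ ∃ e ∈ Vᗮ, ‖e‖ = 1 ∧ A e = (M : ℂ) • e := by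
  have hVo : ∀ v ∈ Vᗮ, A v ∈ Vᗮ := by
    intro v hv
    rw [Submodule.mem_orthogonal]
    intro u hu
    have := hs u v
    simp only [ContinuousLinearMap.coe_coe] at this
    rw [← this]
    exact (Submodule.mem_orthogonal _ _).1 hv _ (hV u hu)
  have : Nontrivial Vᗮ := by
    rw [Submodule.nontrivial_iff_ne_bot]
    intro h
    rw [Submodule.orthogonal_eq_bot_iff] at h
    subst h
    exact hE (Module.Finite.equiv Submodule.topEquiv)
  obtain ⟨e, he, hAe⟩ := exists_eigenvector_norm (A := A.restrict hVo) (hc.restrict' hVo)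
    (hs.restrict_invariant hVo) fun v => hp v
  refine ⟨‖A.restrict hVo‖, (A.restrict hVo).opNorm_nonneg, fun v hv => ?_, e, e.2, he, congrArg Subtype.val hAe⟩
  exact (A.restrict hVo).le_opNorm ⟨v, hv⟩

/-- The min-max values of a positive compact operator are attained by spectral subspaces. -/
theorem exists_spectral_subspaces {A : E →L[ℂ] E} (hc : IsCompactOperator A)
    (hs : (A : E →ₗ[ℂ] E).IsSymmetric) (hp : ∀ v, 0 ≤ (inner ℂ (A v) v).re)
    (hE : ¬ FiniteDimensional ℂ E) (n : ℕ) :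
    ∃ (M : ℝ) (V W : Submodule ℂ E), 0 ≤ M ∧ V ≤ W ∧ FiniteDimensional ℂ V ∧ FiniteDimensional ℂ W ∧
      Module.finrank ℂ V = n ∧ Module.finrank ℂ W = n + 1 ∧ (∀ v ∈ W, A v ∈ W) ∧
      (∀ v ∈ Vᗮ, ‖A v‖ ≤ M * ‖v‖) ∧ (∀ v ∈ W, M * ‖v‖ ^ 2 ≤ (inner ℂ (A v) v).re) := by
  -- One new eigenvector e ⟂ V is adjoined. The last hypothesis says that its eigenvalue M does not
  -- exceed the lower bound M₀ of the form on V, so M is a lower bound on all of V ⊕ ℂe.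
  have step : ∀ (V : Submodule ℂ E) (n : ℕ) (M₀ : ℝ), FiniteDimensional ℂ V →
      Module.finrank ℂ V = n → (∀ v ∈ V, A v ∈ V) →
      (∀ v ∈ V, M₀ * ‖v‖ ^ 2 ≤ (inner ℂ (A v) v).re) →
      (∀ M : ℝ, 0 ≤ M → (∃ e ∈ Vᗮ, ‖e‖ = 1 ∧ A e = (M : ℂ) • e) → M ≤ M₀) →
      ∃ (M : ℝ) (W : Submodule ℂ E), 0 ≤ M ∧ FiniteDimensional ℂ W ∧ V ≤ W ∧
        Module.finrank ℂ W = n + 1 ∧ (∀ v ∈ W, A v ∈ W) ∧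
        (∀ v ∈ Vᗮ, ‖A v‖ ≤ M * ‖v‖) ∧ (∀ v ∈ W, M * ‖v‖ ^ 2 ≤ (inner ℂ (A v) v).re) := by
    intro V n M₀ hfin hdim hV hlow hM₀
    obtain ⟨M, hM, hup, e, heV, he, hAe⟩ := exists_eigenvector_orthogonal hc hs hp hE hV
    have hMM := hM₀ M hM ⟨e, heV, he, hAe⟩
    have he0 : e ≠ 0 := fun h => by simp [h] at he
    refine ⟨M, V ⊔ Submodule.span ℂ {e}, hM, inferInstance, le_sup_left, ?_, ?_, hup, ?_⟩
    · have hdis : V ⊓ Submodule.span ℂ {e} = ⊥ := by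
        rw [eq_bot_iff]
        refine le_trans ?_ (Submodule.inf_orthogonal_eq_bot V).le
        gcongr
        exact (Submodule.span_singleton_le_iff_mem _ _).2 heV
      have := Submodule.finrank_sup_add_finrank_inf_eq V (Submodule.span ℂ {e})
      rw [hdis, finrank_bot, finrank_span_singleton he0, hdim] at this
      exact this
    · intro v hv
      obtain ⟨u, hu, x, hx, rfl⟩ := Submodule.mem_sup.1 hv
      obtain ⟨c, rfl⟩ := Submodule.mem_span_singleton.1 hx
      rw [map_add, map_smul, hAe]
      refine add_mem (Submodule.mem_sup_left (hV u hu)) (Submodule.mem_sup_right ?_)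
      exact Submodule.smul_mem _ _ (Submodule.smul_mem _ _ (Submodule.mem_span_singleton_self e))
    · intro v hv
      obtain ⟨u, hu, x, hx, rfl⟩ := Submodule.mem_sup.1 hv
      obtain ⟨c, rfl⟩ := Submodule.mem_span_singleton.1 hx
      have h1 : inner ℂ u e = 0 := (Submodule.mem_orthogonal _ _).1 heV u hu
      have h2 : inner ℂ (A u) e = 0 := (Submodule.mem_orthogonal _ _).1 heV _ (hV u hu)
      have h3 : inner ℂ e u = 0 := by rw [← inner_conj_symm, h1, map_zero]
      have hn : ‖u + c • e‖ ^ 2 = ‖u‖ ^ 2 + ‖c‖ ^ 2 := by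
        have := norm_add_sq (𝕜 := ℂ) u (c • e)
        rw [inner_smul_right, h1, mul_zero, norm_smul, he, mul_one] at this
        simpa using this
      have hi : (inner ℂ (A (u + c • e)) (u + c • e)).re =
          (inner ℂ (A u) u).re + M * ‖c‖ ^ 2 := by
        have hee : inner ℂ e e = (1 : ℂ) := by
          rw [inner_self_eq_norm_sq_to_K, he]
          simp
        simp only [map_add, map_smul, hAe, inner_add_left, inner_add_right, inner_smul_left,
          inner_smul_right, h2, h3, hee, mul_zero, add_zero, mul_one, zero_add, Complex.add_re]
        congr 1
        rw [Complex.conj_ofReal, ← mul_assoc, Complex.mul_conj', mul_comm]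
        norm_cast
      rw [hn, hi, mul_add]
      have := hlow u hu
      have : M * ‖u‖ ^ 2 ≤ M₀ * ‖u‖ ^ 2 := by gcongr
      linarith
  induction n with
  | zero =>
    -- On the zero subspace any M₀ is a lower bound; ‖A‖ also dominates every eigenvalue.
    obtain ⟨M, W, hM, hW, hle, h1, h2, h3, h4⟩ := step ⊥ 0 ‖A‖ inferInstance (finrank_bot ℂ E)
      (fun v hv => by rw [(Submodule.mem_bot ℂ).1 hv, map_zero]; exact Submodule.zero_mem _)
      (fun v hv => by rw [(Submodule.mem_bot ℂ).1 hv]; simp)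
      (fun M hM ⟨e, _, he, hAe⟩ => by
        have := A.le_opNorm e
        rwa [hAe, norm_smul, he, Complex.norm_of_nonneg hM, mul_one, mul_one] at this)
    exact ⟨M, ⊥, W, hM, hle, inferInstance, hW, finrank_bot ℂ E, h1, h2, h3, h4⟩
  | succ n ih =>
    obtain ⟨M₀, V₀, V, hM₀, hle₀, hV₀, hV, h1, h2, h3, h4, h5⟩ := ih
    obtain ⟨M, W, hM, hW, hle, g1, g2, g3, g4⟩ := step V (n + 1) M₀ hV h2 h3 h5
      fun M hM ⟨e, heV, he, hAe⟩ => by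
        have := h4 e (Submodule.orthogonal_le hle₀ heV)
        rwa [hAe, norm_smul, he, Complex.norm_of_nonneg hM, mul_one, mul_one] at this
    exact ⟨M, V, W, hM, hle, hV, hW, h2, g1, g2, g3, g4⟩

end Spectral

/-! ### Min-max estimates for singular values -/

section SingularValues

theorem not_finiteDimensional_ellTwo : ¬ FiniteDimensional ℂ EllTwo := by
  intro h
  have := orthonormal_unitVec.linearIndependent
  exact not_finite_iff_infinite.2 inferInstance this.finite_of_isNoetherian

/-- The span of the first `n` vectors of the standard basis. -/
noncomputable def initialSpan (n : ℕ) : Submodule ℂ EllTwo :=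
  Submodule.span ℂ (Set.range fun i : Fin n => unitVec i)

instance (n : ℕ) : FiniteDimensional ℂ (initialSpan n) :=
  FiniteDimensional.span_of_finite ℂ (Set.finite_range _)

theorem finrank_initialSpan (n : ℕ) : Module.finrank ℂ (initialSpan n) = n := by
  have := finrank_span_eq_card
    (orthonormal_unitVec.linearIndependent.comp _ (Fin.val_injective (n := n)))
  rwa [Fintype.card_fin] at this

theorem apply_eq_zero_of_mem_orthogonal_initialSpan {n : ℕ} {v : EllTwo}
    (hv : v ∈ (initialSpan n)ᗮ) {k : ℕ} (hk : k < n) : v k = 0 := by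
  rw [← inner_unitVec]
  exact (Submodule.mem_orthogonal _ _).1 hv _ (Submodule.subset_span ⟨⟨k, hk⟩, rfl⟩)

/-- The orthogonal projection of W to the smaller space V has a kernel. -/
theorem exists_unit_mem_inf_orthogonal {V W : Submodule ℂ EllTwo} [FiniteDimensional ℂ V]
    [FiniteDimensional ℂ W] (h : Module.finrank ℂ V < Module.finrank ℂ W) :
    ∃ v ∈ W, v ∈ Vᗮ ∧ ‖v‖ = 1 := by
  have hker := LinearMap.ker_ne_bot_of_finrank_lt
    (f := (V.orthogonalProjectionOnto : EllTwo →ₗ[ℂ] V) ∘ₗ W.subtype) h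
  obtain ⟨v, hv, hv0⟩ := Submodule.exists_mem_ne_zero_of_ne_bot hker
  have hv' : V.orthogonalProjectionOnto (v : EllTwo) = 0 := hv
  rw [Submodule.orthogonalProjectionOnto_eq_zero_iff] at hv'
  have hn : ‖(v : EllTwo)‖ ≠ 0 := by simpa using hv0
  refine ⟨((‖(v : EllTwo)‖⁻¹ : ℝ) : ℂ) • (v : EllTwo), W.smul_mem _ v.2,
    Submodule.smul_mem _ _ hv', ?_⟩
  rw [norm_smul, Complex.norm_of_nonneg (by positivity), inv_mul_cancel₀ hn]

theorem singularValue_le {T : EllTwo →L[ℂ] EllTwo} {n : ℕ} {M : ℝ} (hM : 0 ≤ M)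
    {V : Submodule ℂ EllTwo} [FiniteDimensional ℂ V] (hV : Module.finrank ℂ V = n)
    (h : ∀ v ∈ Vᗮ, ‖v‖ = 1 → ‖T v‖ ≤ M) : singularValue T n ≤ M := by
  refine le_trans (b := sSup {t : ℝ | ∃ v : EllTwo, v ∈ Vᗮ ∧ ‖v‖ = 1 ∧ t = ‖T v‖})
    (csInf_le ⟨0, ?_⟩ ⟨V, ?_, rfl⟩) (Real.sSup_le ?_ hM)
  · rintro _ ⟨V, -, rfl⟩
    refine Real.sSup_nonneg ?_
    rintro _ ⟨v, -, -, rfl⟩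
    exact norm_nonneg _
  · rw [← Module.finrank_eq_rank, hV]
  · rintro _ ⟨v, hv, hv1, rfl⟩
    exact h v hv hv1

theorem le_singularValue {T : EllTwo →L[ℂ] EllTwo} {n : ℕ} {m : ℝ}
    {W : Submodule ℂ EllTwo} [FiniteDimensional ℂ W] (hW : Module.finrank ℂ W = n + 1)
    (h : ∀ v ∈ W, ‖v‖ = 1 → m ≤ ‖T v‖) : m ≤ singularValue T n := by
  refine le_csInf ?_ ?_
  -- Competitors V exist; without this the infimum would take the default value 0.
  · exact ⟨_, initialSpan n, by rw [← Module.finrank_eq_rank, finrank_initialSpan], rfl⟩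
  · rintro _ ⟨V, hV, rfl⟩
    have : FiniteDimensional ℂ V := by
      rw [FiniteDimensional, ← Module.rank_lt_aleph0_iff, hV]
      exact Cardinal.natCast_lt_aleph0
    obtain ⟨v, hvW, hvV, hv⟩ := exists_unit_mem_inf_orthogonal (V := V) (W := W) (by
      rw [hW, Module.finrank_eq_of_rank_eq hV]
      exact n.lt_succ_self)
    refine (h v hvW hv).trans (le_csSup ⟨‖T‖, ?_⟩ ⟨v, hvV, hv, rfl⟩)
    rintro _ ⟨u, -, hu, rfl⟩
    simpa [hu] using T.le_opNorm u

theorem singularValue_nonneg (T : EllTwo →L[ℂ] EllTwo) (n : ℕ) : 0 ≤ singularValue T n :=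
  le_singularValue (finrank_initialSpan (n + 1)) fun _ _ _ => norm_nonneg _

theorem singularValue_columnOperator_le {r : ℕ → EllTwo} (hr : Summable fun k => ‖r k‖) (n : ℕ) :
    singularValue (columnOperator r) n ≤ ∑' k, ‖r (k + n)‖ :=
  singularValue_le (V := initialSpan n) (tsum_nonneg fun _ => norm_nonneg _) (finrank_initialSpan n) fun _ hv hv1 =>
    norm_columnOperator_apply_le hr
      (fun _ hk => apply_eq_zero_of_mem_orthogonal_initialSpan hv hk) hv1

/-- The singular values of `T* T` are the squares of those of `T`. -/
theorem singularValue_adjoint_comp_self {T : EllTwo →L[ℂ] EllTwo} (hT : IsCompactOperator T)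
    (n : ℕ) :
    singularValue (ContinuousLinearMap.adjoint T ∘L T) n = singularValue T n ^ 2 := by
  obtain ⟨A, hA⟩ : ∃ A, A = ContinuousLinearMap.adjoint T ∘L T := ⟨_, rfl⟩
  have hin : ∀ v, inner ℂ (A v) v = ((‖T v‖ ^ 2 : ℝ) : ℂ) := fun v => by
    rw [hA, ContinuousLinearMap.comp_apply, ContinuousLinearMap.adjoint_inner_left,
      inner_self_eq_norm_sq_to_K]
    norm_cast
  have hre : ∀ v, (inner ℂ (A v) v).re = ‖T v‖ ^ 2 := fun v => by rw [hin, Complex.ofReal_re]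
  have hsym : (A : EllTwo →ₗ[ℂ] EllTwo).IsSymmetric := fun u v => by
    rw [hA]
    simp [ContinuousLinearMap.adjoint_inner_left, ContinuousLinearMap.adjoint_inner_right]
  have hcomp : IsCompactOperator A := by
    rw [hA]
    exact hT.clm_comp (ContinuousLinearMap.adjoint T)
  -- The same subspaces serve A and T: for unit vectors, ‖T v‖² = ⟨A v, v⟩ ≥ M on W, and ‖T v‖² ≤ ‖A
  -- v‖ ≤ M on Vᗮ.
  obtain ⟨M, V, W, hM, -, hV, hW, h1, h2, -, h4, h5⟩ := exists_spectral_subspaces hcomp hsym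
    (fun v => by rw [hre]; exact sq_nonneg _) not_finiteDimensional_ellTwo n
  have hle : ∀ v, ‖v‖ = 1 → ‖T v‖ ^ 2 ≤ ‖A v‖ := fun v hv => by
    rw [← hre]
    refine (Complex.re_le_norm _).trans ((norm_inner_le_norm _ _).trans ?_)
    rw [hv, mul_one]
  rw [← hA]
  have e1 : singularValue A n = M := by
    refine le_antisymm (singularValue_le hM h1 fun v hv hv1 => ?_)
      (le_singularValue h2 fun v hv hv1 => ?_)
    · simpa [hv1] using h4 v hv
    · have := h5 v hv
      rw [hre, hv1, one_pow, mul_one] at this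
      exact this.trans (hle v hv1)
  have e2 : singularValue T n = Real.sqrt M := by
    refine le_antisymm (singularValue_le (Real.sqrt_nonneg _) h1 fun v hv hv1 => ?_)
      (le_singularValue h2 fun v hv hv1 => ?_)
    · refine Real.le_sqrt_of_sq_le ((hle v hv1).trans ?_)
      simpa [hv1] using h4 v hv
    · have := h5 v hv
      rw [hre, hv1, one_pow, mul_one] at this
      exact Real.sqrt_le_iff.2 ⟨norm_nonneg _, this⟩
  rw [e1, e2, Real.sq_sqrt hM]

end SingularValues

/-! ### Courant-Fischer inequality -/

section CourantFischer

variable {E : Type*} [NormedAddCommGroup E] [InnerProductSpace ℝ E] [FiniteDimensional ℝ E]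
  {T : E →ₗ[ℝ] E} {m : ℕ}

theorem inner_apply_self_eq_sum_eigenvalues (hT : T.IsSymmetric) (hm : Module.finrank ℝ E = m)
    (v : E) :
    inner ℝ v (T v) = ∑ i, hT.eigenvalues hm i * inner ℝ (hT.eigenvectorBasis hm i) v ^ 2 := by
  rw [← (hT.eigenvectorBasis hm).sum_inner_mul_inner v (T v)]
  refine Finset.sum_congr rfl fun i _ => ?_
  rw [← hT, hT.apply_eigenvectorBasis, inner_smul_left, real_inner_comm]
  simp
  ring

theorem norm_sq_eq_sum_eigenvectorBasis (hT : T.IsSymmetric) (hm : Module.finrank ℝ E = m)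
    (v : E) : ‖v‖ ^ 2 = ∑ i, inner ℝ (hT.eigenvectorBasis hm i) v ^ 2 := by
  rw [← (hT.eigenvectorBasis hm).sum_sq_norm_inner_right v]
  simp

/-- The span of the eigenvectors with indices in `s`. -/
noncomputable def eigenvectorSpan (hT : T.IsSymmetric) (hm : Module.finrank ℝ E = m)
    (s : Finset (Fin m)) : Submodule ℝ E :=
  Submodule.span ℝ (Set.range fun i : s => hT.eigenvectorBasis hm i)

theorem finrank_eigenvectorSpan (hT : T.IsSymmetric) (hm : Module.finrank ℝ E = m)
    (s : Finset (Fin m)) : Module.finrank ℝ (eigenvectorSpan hT hm s) = s.card := by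
  have := finrank_span_eq_card ((hT.eigenvectorBasis hm).orthonormal.linearIndependent.comp _
    (Subtype.val_injective (p := fun i => i ∈ s)))
  rwa [Fintype.card_coe] at this

theorem inner_eq_zero_of_mem_eigenvectorSpan (hT : T.IsSymmetric) (hm : Module.finrank ℝ E = m)
    {s : Finset (Fin m)} {v : E} (hv : v ∈ eigenvectorSpan hT hm s) {i : Fin m} (hi : i ∉ s) :
    inner ℝ (hT.eigenvectorBasis hm i) v = 0 := by
  have h : eigenvectorSpan hT hm s ≤ LinearMap.ker (innerₛₗ ℝ (hT.eigenvectorBasis hm i)) := by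
    refine Submodule.span_le.2 ?_
    rintro _ ⟨j, rfl⟩
    exact (hT.eigenvectorBasis hm).orthonormal.2 fun h => hi (h ▸ j.2)
  exact h hv

theorem inner_apply_self_le_of_mem_eigenvectorSpan (hT : T.IsSymmetric)
    (hm : Module.finrank ℝ E = m) (j : Fin m) {v : E}
    (hv : v ∈ eigenvectorSpan hT hm (Finset.Ici j)) :
    inner ℝ v (T v) ≤ hT.eigenvalues hm j * ‖v‖ ^ 2 := by
  rw [inner_apply_self_eq_sum_eigenvalues hT hm, norm_sq_eq_sum_eigenvectorBasis hT hm,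
    Finset.mul_sum]
  refine Finset.sum_le_sum fun i _ => ?_
  by_cases hi : i ∈ Finset.Ici j
  · have := hT.eigenvalues_antitone hm (Finset.mem_Ici.1 hi)
    gcongr
  · simp [inner_eq_zero_of_mem_eigenvectorSpan hT hm hv hi]

theorem le_inner_apply_self_of_mem_eigenvectorSpan (hT : T.IsSymmetric)
    (hm : Module.finrank ℝ E = m) (j : Fin m) {v : E}
    (hv : v ∈ eigenvectorSpan hT hm (Finset.Iic j)) :
    hT.eigenvalues hm j * ‖v‖ ^ 2 ≤ inner ℝ v (T v) := by
  rw [inner_apply_self_eq_sum_eigenvalues hT hm, norm_sq_eq_sum_eigenvectorBasis hT hm,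
    Finset.mul_sum]
  refine Finset.sum_le_sum fun i _ => ?_
  by_cases hi : i ∈ Finset.Iic j
  · have := hT.eigenvalues_antitone hm (Finset.mem_Iic.1 hi)
    gcongr
  · simp [inner_eq_zero_of_mem_eigenvectorSpan hT hm hv hi]

/-- One half of the Courant-Fischer theorem. -/
theorem eigenvalues_le_of_forall_mem (hT : T.IsSymmetric) (hm : Module.finrank ℝ E = m) (j : Fin m)
    {W : Submodule ℝ E} (hW : m ≤ Module.finrank ℝ W + j) {t : ℝ}
    (h : ∀ v ∈ W, inner ℝ v (T v) ≤ t * ‖v‖ ^ 2) : hT.eigenvalues hm j ≤ t := by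
  -- The eigenvectors with indices 0, …, j span j + 1 dimensions, one too many to miss W.
  have hne : W ⊓ eigenvectorSpan hT hm (Finset.Iic j) ≠ ⊥ := by
    intro hbot
    have h1 := Submodule.finrank_sup_add_finrank_inf_eq W (eigenvectorSpan hT hm (Finset.Iic j))
    have h2 := Submodule.finrank_le (W ⊔ eigenvectorSpan hT hm (Finset.Iic j))
    rw [hbot, finrank_bot, finrank_eigenvectorSpan, Fin.card_Iic] at h1
    omega
  obtain ⟨v, hv, hv0⟩ := Submodule.exists_mem_ne_zero_of_ne_bot hne
  have h1 := h v hv.1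
  have h2 := le_inner_apply_self_of_mem_eigenvectorSpan hT hm j hv.2
  have : 0 < ‖v‖ ^ 2 := by positivity
  exact le_of_mul_le_mul_right (h2.trans h1) this

end CourantFischer

/-! ### Hankel eigenvalues and interlacing -/

section Hankel

/-- The Hankel matrix as an operator on Euclidean space. -/
noncomputable def hankelLin (μ : Measure ℝ) (N : ℕ) :
    EuclideanSpace ℝ (Fin (N + 1)) →ₗ[ℝ] EuclideanSpace ℝ (Fin (N + 1)) :=
  Matrix.toEuclideanLin (hankel μ N)

theorem hankelLin_isSymmetric (μ : Measure ℝ) (N : ℕ) : (hankelLin μ N).IsSymmetric :=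
  Matrix.isSymmetric_toEuclideanLin_iff.mpr (hankel_isHermitian μ N)

theorem inner_hankelLin (μ : Measure ℝ) (N : ℕ) (x y : EuclideanSpace ℝ (Fin (N + 1))) :
    inner ℝ x (hankelLin μ N y) = ∑ i, ∑ j, x i * y j * moment μ (i.val + j.val) := by
  rw [PiLp.inner_apply]
  refine Finset.sum_congr rfl fun i _ => ?_
  simp only [hankelLin, Matrix.toLpLin_apply, Matrix.mulVec, dotProduct, hankel, Matrix.of_apply]
  rw [RCLike.inner_apply, Finset.sum_mul]
  refine Finset.sum_congr rfl fun j _ => ?_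
  simp
  ring

theorem hankelEigenvalue_eq (μ : Measure ℝ) {N n : ℕ} (h : n ≤ N) :
    hankelEigenvalue μ N n =
      (hankelLin_isSymmetric μ N).eigenvalues finrank_euclideanSpace ⟨N - n, by simp⟩ := by
  rw [hankelEigenvalue, if_pos h]
  rfl

/-- Padding with a zero. -/
noncomputable def snocZero (m : ℕ) :
    EuclideanSpace ℝ (Fin m) →ₗ[ℝ] EuclideanSpace ℝ (Fin (m + 1)) where
  toFun x := WithLp.toLp 2 (Fin.snoc (α := fun _ => ℝ) x.ofLp 0)
  map_add' x y := by
    ext i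
    refine Fin.lastCases ?_ (fun i => ?_) i <;> simp
  map_smul' c x := by
    ext i
    refine Fin.lastCases ?_ (fun i => ?_) i <;> simp

theorem snocZero_castSucc {m : ℕ} (x : EuclideanSpace ℝ (Fin m)) (i : Fin m) :
    snocZero m x i.castSucc = x i := by
  simp [snocZero]

theorem snocZero_last {m : ℕ} (x : EuclideanSpace ℝ (Fin m)) :
    snocZero m x (Fin.last m) = 0 := by
  simp [snocZero]

theorem norm_sq_snocZero {m : ℕ} (x : EuclideanSpace ℝ (Fin m)) :
    ‖snocZero m x‖ ^ 2 = ‖x‖ ^ 2 := by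
  rw [EuclideanSpace.norm_sq_eq, EuclideanSpace.norm_sq_eq, Fin.sum_univ_castSucc]
  simp only [snocZero_castSucc, snocZero_last]
  simp

theorem snocZero_injective (m : ℕ) : Function.Injective (snocZero m) := by
  refine (injective_iff_map_eq_zero _).2 fun x hx => ?_
  have := norm_sq_snocZero x
  rw [hx] at this
  simpa using this.symm

theorem inner_hankelLin_snocZero (μ : Measure ℝ) (N : ℕ) (x : EuclideanSpace ℝ (Fin (N + 1))) :
    inner ℝ (snocZero _ x) (hankelLin μ (N + 1) (snocZero _ x)) =
      inner ℝ x (hankelLin μ N x) := by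
  rw [inner_hankelLin, inner_hankelLin, Fin.sum_univ_castSucc]
  simp only [Fin.sum_univ_castSucc (n := N + 1), snocZero_castSucc, snocZero_last]
  simp

/-- Cauchy interlacing. -/
theorem hankelEigenvalue_succ_le (μ : Measure ℝ) {N n : ℕ} (h : n ≤ N) :
    hankelEigenvalue μ (N + 1) n ≤ hankelEigenvalue μ N n := by
  rw [hankelEigenvalue_eq μ h, hankelEigenvalue_eq μ (h.trans N.le_succ)]
  obtain ⟨j, hj⟩ : ∃ j : Fin (Fintype.card (Fin (N + 1))), j = ⟨N - n, by simp⟩ := ⟨_, rfl⟩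
  rw [← hj]
  -- W consists of the padded eigenvectors of the n + 1 smallest eigenvalues of H_N. The index in
  -- the larger matrix is N + 1 - n, and (n + 1) + (N + 1 - n) = N + 2 is its size.
  refine eigenvalues_le_of_forall_mem _ _ _ (W := (eigenvectorSpan (hankelLin_isSymmetric μ N)
    finrank_euclideanSpace (Finset.Ici j)).map (snocZero _)) ?_ ?_
  · rw [← (Submodule.equivMapOfInjective _ (snocZero_injective _) _).finrank_eq]
    rw [finrank_eigenvectorSpan, Fin.card_Ici, hj]
    simp
    omega
  · rintro _ ⟨x, hx, rfl⟩
    rw [inner_hankelLin_snocZero, norm_sq_snocZero]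
    exact inner_apply_self_le_of_mem_eigenvectorSpan _ _ _ hx

end Hankel

/-! ### Lower bound by biorthogonality -/

/-- A lower bound for singular values from a biorthogonal system. -/
theorem le_singularValue_sq {T : EllTwo →L[ℂ] EllTwo} {ι : Type*} [Fintype ι] [DecidableEq ι]
    {u d : ι → EllTwo} {c : ι → ℝ} {t : ℝ} {n : ℕ} (hu : Orthonormal ℂ u)
    (hd : ∀ i j, inner ℂ (d i) (d j) = if i = j then (c i : ℂ) else 0)
    (hT : ∀ i, ContinuousLinearMap.adjoint T (d i) = u i) (hc : ∀ i, c i ≤ t) (ht : 0 < t)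
    (hn : Fintype.card ι = n + 1) : 1 / t ≤ singularValue T n ^ 2 := by
  have hfin : FiniteDimensional ℂ (Submodule.span ℂ (Set.range u)) :=
    FiniteDimensional.span_of_finite ℂ (Set.finite_range _)
  have key : (Real.sqrt t)⁻¹ ≤ singularValue T n := by
    refine le_singularValue (W := Submodule.span ℂ (Set.range u))
      ((finrank_span_eq_card hu.linearIndependent).trans hn) fun v hv hv1 => ?_
    obtain ⟨a, rfl⟩ := (Submodule.mem_span_range_iff_exists_fun ℂ).1 hv
    obtain ⟨D, hD⟩ : ∃ D, D = ∑ i, a i • d i := ⟨_, rfl⟩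
    have hTD : ContinuousLinearMap.adjoint T D = ∑ i, a i • u i := by
      simp only [hD, map_sum, map_smul, hT]
    have hu2 : ‖∑ i, a i • u i‖ ^ 2 = ∑ i, ‖a i‖ ^ 2 := by
      have h1 := hu.inner_sum a a Finset.univ
      rw [inner_self_eq_norm_sq_to_K] at h1
      simp only [Complex.conj_mul'] at h1
      have h2 := congrArg Complex.re h1
      norm_cast at h2
    have hD2 : ‖D‖ ^ 2 = ∑ i, c i * ‖a i‖ ^ 2 := by
      have h1 : inner ℂ D D = ∑ i, ((c i * ‖a i‖ ^ 2 : ℝ) : ℂ) := by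
        rw [hD]
        simp only [sum_inner, inner_sum, inner_smul_left, inner_smul_right, hd]
        refine Finset.sum_congr rfl fun i _ => ?_
        simp only [mul_ite, mul_zero, Finset.sum_ite_eq', Finset.mem_univ, if_true]
        rw [← mul_assoc, Complex.mul_conj']
        push_cast
        ring
      rw [inner_self_eq_norm_sq_to_K] at h1
      have h2 := congrArg Complex.re h1
      norm_cast at h2
    have hle : ‖D‖ ≤ Real.sqrt t := by
      refine Real.le_sqrt_of_sq_le ?_
      rw [hD2]
      calc ∑ i, c i * ‖a i‖ ^ 2 ≤ ∑ i, t * ‖a i‖ ^ 2 := by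
            refine Finset.sum_le_sum fun i _ => ?_
            have := hc i
            gcongr
        _ = t := by rw [← Finset.mul_sum, ← hu2, hv1, one_pow, mul_one]
    -- For the unit vector v = ∑ a_i u_i, ⟨T v, D⟩ = ⟨v, T*D⟩ = ‖v‖² = 1, so ‖T v‖ ≥ 1/‖D‖ ≥
    -- t^{-1/2}.
    have h1 : inner ℂ (T (∑ i, a i • u i)) D = 1 := by
      rw [← ContinuousLinearMap.adjoint_inner_right, hTD, inner_self_eq_norm_sq_to_K, hv1]
      simp
    have h2 := norm_inner_le_norm (𝕜 := ℂ) (T (∑ i, a i • u i)) D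
    rw [h1, norm_one] at h2
    rw [inv_le_iff_one_le_mul₀ (Real.sqrt_pos.2 ht)]
    exact h2.trans (by gcongr)
  have h0 : 0 ≤ (Real.sqrt t)⁻¹ := by positivity
  calc 1 / t = (Real.sqrt t)⁻¹ ^ 2 := by rw [inv_pow, Real.sq_sqrt ht.le, one_div]
    _ ≤ _ := by gcongr

/-! ### Coefficient vectors, Fourier coefficients and Hankel forms -/

section Embedding

variable {μ : Measure ℝ}

/-- The real polynomial with coefficient vector `x`. -/
noncomputable def vecPoly {m : ℕ} (x : EuclideanSpace ℝ (Fin m)) : ℝ[X] :=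
  ∑ i, C (x i) * X ^ i.val

theorem degree_vecPoly_lt {m : ℕ} (x : EuclideanSpace ℝ (Fin m)) : (vecPoly x).degree < m := by
  refine (degree_sum_le _ _).trans_lt
    ((Finset.sup_lt_iff (WithBot.bot_lt_coe m)).2 fun i _ => ?_)
  exact (degree_C_mul_X_pow_le _ _).trans_lt (WithBot.coe_lt_coe.2 i.isLt)

/-- The embedding of Euclidean space into `ℓ²`. -/
noncomputable def vecEmbed {m : ℕ} (x : EuclideanSpace ℝ (Fin m)) : EllTwo :=
  ∑ i, (x i : ℂ) • unitVec i

/-- The vector of Fourier coefficients of `vecPoly x` with respect to the orthonormal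
polynomials. -/
noncomputable def fourierEmbed (μ : Measure ℝ) {m : ℕ} (x : EuclideanSpace ℝ (Fin m)) : EllTwo :=
  ∑ i : Fin m, ((∫ t, (vecPoly x * orthoPoly μ i).eval t ∂μ : ℝ) : ℂ) • unitVec i

theorem inner_sum_smul_unitVec {m : ℕ} (a b : Fin m → ℝ) :
    inner ℂ (∑ i, (a i : ℂ) • unitVec i) (∑ i, (b i : ℂ) • unitVec i) =
      ((∑ i, a i * b i : ℝ) : ℂ) := by
  have ho : Orthonormal ℂ fun i : Fin m => unitVec i :=
    orthonormal_unitVec.comp _ Fin.val_injective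
  have := ho.inner_sum (fun i => (a i : ℂ)) (fun i => (b i : ℂ)) Finset.univ
  rw [this]
  push_cast
  simp

theorem inner_vecEmbed {m : ℕ} (x y : EuclideanSpace ℝ (Fin m)) :
    inner ℂ (vecEmbed x) (vecEmbed y) = ((inner ℝ x y : ℝ) : ℂ) := by
  rw [vecEmbed, vecEmbed, inner_sum_smul_unitVec, PiLp.inner_apply]
  congr 1
  exact Finset.sum_congr rfl fun i _ => by simp [mul_comm]

theorem momentFunctional_map (h : HasAllMoments μ) (p : ℝ[X]) :
    momentFunctional μ (p.map (algebraMap ℝ ℂ)) = ((∫ t, p.eval t ∂μ : ℝ) : ℂ) := by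
  rw [momentFunctional_eq_integral h fun _ => rfl, ← integral_complex_ofReal]
  refine integral_congr_ae (ae_of_all _ fun x => ?_)
  simp only [eval_map]
  exact eval₂_at_apply (algebraMap ℝ ℂ) x

theorem vecPoly_expansion (h : HasAllMoments μ) (hs : μ.support.Infinite) {m : ℕ}
    (x : EuclideanSpace ℝ (Fin m)) :
    vecPoly x = ∑ i : Fin m, C (∫ t, (vecPoly x * orthoPoly μ i).eval t ∂μ) * orthoPoly μ i := by
  have h1 := (isOrthonormalFor_complexOrthoPoly h hs).expansion m
    ((vecPoly x).map (algebraMap ℝ ℂ)) (by rw [degree_map]; exact degree_vecPoly_lt x)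
  refine Polynomial.map_injective (algebraMap ℝ ℂ) (algebraMap ℝ ℂ).injective ?_
  rw [h1, Polynomial.map_sum, Finset.sum_range]
  refine Finset.sum_congr rfl fun i _ => ?_
  rw [complexOrthoPoly, ← Polynomial.map_mul, momentFunctional_map h, Polynomial.map_mul, map_C]
  rfl

/-- Parseval: both sides equal the integral of `vecPoly x * vecPoly y`, expanded once in orthonormal
polynomials and once in monomials. -/
theorem inner_fourierEmbed (h : HasAllMoments μ) (hs : μ.support.Infinite) {N : ℕ}
    (x y : EuclideanSpace ℝ (Fin (N + 1))) :
    inner ℂ (fourierEmbed μ x) (fourierEmbed μ y) = ((inner ℝ x (hankelLin μ N y) : ℝ) : ℂ) := by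
  rw [fourierEmbed, fourierEmbed, inner_sum_smul_unitVec, inner_hankelLin]
  congr 1
  have e1 : ∫ t, (vecPoly x * vecPoly y).eval t ∂μ = ∑ i : Fin (N + 1),
      (∫ t, (vecPoly x * orthoPoly μ i).eval t ∂μ) *
        ∫ t, (vecPoly y * orthoPoly μ i).eval t ∂μ := by
    have e : ∀ t, (vecPoly x * vecPoly y).eval t = ∑ i : Fin (N + 1),
        (vecPoly x * orthoPoly μ i).eval t * ∫ t, (vecPoly y * orthoPoly μ i).eval t ∂μ := by
      intro t
      conv_lhs => rw [vecPoly_expansion h hs y]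
      rw [eval_mul, eval_finsetSum, Finset.mul_sum]
      refine Finset.sum_congr rfl fun i _ => ?_
      rw [eval_mul, eval_mul, eval_C]
      ring
    simp only [e]
    rw [integral_finsetSum _ fun i _ => (integrable_eval h _).mul_const _]
    simp only [integral_mul_const]
  have e2 : ∫ t, (vecPoly x * vecPoly y).eval t ∂μ =
      ∑ i, ∑ j, x i * y j * moment μ (i.val + j.val) := by
    have e : ∀ t, (vecPoly x * vecPoly y).eval t =
        ∑ i, ∑ j, x i * y j * t ^ (i.val + j.val) := by
      intro t
      simp only [vecPoly, eval_mul, eval_finsetSum, eval_C, eval_pow, eval_X]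
      rw [Finset.sum_mul_sum]
      refine Finset.sum_congr rfl fun i _ => Finset.sum_congr rfl fun j _ => ?_
      ring
    simp only [e]
    rw [integral_finsetSum _ fun i _ => integrable_finsetSum _ fun j _ => (h _).const_mul _]
    refine Finset.sum_congr rfl fun i _ => ?_
    rw [integral_finsetSum _ fun j _ => (h _).const_mul _]
    simp only [integral_const_mul, moment]
  rw [← e1, e2]

/-- The adjoint is the change of basis B from orthonormal polynomials to monomials: the k-th
coordinate is the coefficient of X^k in the Fourier expansion. -/
theorem adjoint_columnOperator_fourierEmbed (h : HasAllMoments μ) (hs : μ.support.Infinite)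
    {r : ℕ → EllTwo} (hr : Summable fun k => ‖r k‖)
    (hcoef : ∀ k n, r k n = (((orthoPoly μ n).coeff k : ℝ) : ℂ)) {m : ℕ}
    (x : EuclideanSpace ℝ (Fin m)) :
    ContinuousLinearMap.adjoint (columnOperator r) (fourierEmbed μ x) = vecEmbed x := by
  refine lp.ext (funext fun k => ?_)
  rw [← inner_unitVec, ← inner_unitVec, ContinuousLinearMap.adjoint_inner_right,
    columnOperator_unitVec hr, fourierEmbed, vecEmbed, inner_sum, inner_sum]
  have e1 : ∀ i : Fin m, inner ℂ (r k)
      (((∫ t, (vecPoly x * orthoPoly μ i).eval t ∂μ : ℝ) : ℂ) • unitVec i) =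
      (((C (∫ t, (vecPoly x * orthoPoly μ i).eval t ∂μ) * orthoPoly μ i).coeff k : ℝ) : ℂ) := by
    intro i
    rw [inner_smul_right, ← inner_conj_symm, inner_unitVec, hcoef, Complex.conj_ofReal,
      coeff_C_mul, Complex.ofReal_mul]
  have e2 : ∀ i : Fin m, inner ℂ (unitVec k) ((x i : ℂ) • unitVec i) =
      (((C (x i) * X ^ i.val).coeff k : ℝ) : ℂ) := by
    intro i
    rw [inner_smul_right, orthonormal_iff_ite.1 orthonormal_unitVec, coeff_C_mul, coeff_X_pow]
    split_ifs <;> simp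
  simp only [e1, e2]
  rw [← Complex.ofReal_sum, ← Complex.ofReal_sum, ← finsetSum_coeff, ← finsetSum_coeff,
    ← vecPoly_expansion h hs x, vecPoly]

/-- The Hankel eigenvalues are positive and bound the singular values of `B*` from below. -/
theorem hankelEigenvalue_pos_and_le (h : HasAllMoments μ) (hs : μ.support.Infinite)
    {r : ℕ → EllTwo} (hr : Summable fun k => ‖r k‖)
    (hcoef : ∀ k n, r k n = (((orthoPoly μ n).coeff k : ℝ) : ℂ)) {n N : ℕ} (hn : n ≤ N) :
    0 < hankelEigenvalue μ N n ∧
      1 / hankelEigenvalue μ N n ≤ singularValue (columnOperator r) n ^ 2 := by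
  rw [hankelEigenvalue_eq μ hn]
  obtain ⟨hT, hdef⟩ : ∃ hT, hT = hankelLin_isSymmetric μ N := ⟨_, rfl⟩
  rw [← hdef]
  obtain ⟨e, he⟩ : ∃ e, e = hT.eigenvectorBasis finrank_euclideanSpace := ⟨_, rfl⟩
  obtain ⟨ev, hev⟩ : ∃ ev, ev = hT.eigenvalues finrank_euclideanSpace := ⟨_, rfl⟩
  rw [← hev]
  have hHe : ∀ i, hankelLin μ N (e i) = ev i • e i := fun i => by
    rw [he, hT.apply_eigenvectorBasis, hev]
    rfl
  have hd : ∀ i j, inner ℂ (fourierEmbed μ (e i)) (fourierEmbed μ (e j)) =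
      if i = j then (ev i : ℂ) else 0 := by
    intro i j
    rw [inner_fourierEmbed h hs, hHe, inner_smul_right, orthonormal_iff_ite.1 e.orthonormal]
    split_ifs with hij
    · simp [hij]
    · simp
  have hu : Orthonormal ℂ fun i => vecEmbed (e i) := by
    rw [orthonormal_iff_ite]
    intro i j
    rw [inner_vecEmbed, orthonormal_iff_ite.1 e.orthonormal]
    split_ifs <;> simp
  have hTd : ∀ i, ContinuousLinearMap.adjoint (columnOperator r) (fourierEmbed μ (e i)) =
      vecEmbed (e i) := fun i => adjoint_columnOperator_fourierEmbed h hs hr hcoef _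
  -- The eigenvalue is the squared norm of a vector that the adjoint sends to a unit vector.
  have hpos : ∀ i, 0 < ev i := by
    intro i
    have h1 := hd i i
    rw [if_pos rfl, inner_self_eq_norm_sq_to_K] at h1
    have h2 : ‖fourierEmbed μ (e i)‖ ^ 2 = ev i := by
      have h3 := congrArg Complex.re h1
      norm_cast at h3
    rw [← h2]
    have : fourierEmbed μ (e i) ≠ 0 := by
      intro h0
      have := hTd i
      rw [h0, map_zero] at this
      have h3 := hu.1 i
      simp only [← this, norm_zero] at h3
      exact zero_ne_one h3
    positivity
  obtain ⟨j, hj⟩ : ∃ j : Fin (Fintype.card (Fin (N + 1))), j = ⟨N - n, by simp⟩ := ⟨_, rfl⟩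
  rw [← hj]
  -- Eigenvalues are listed decreasingly, so the indices from j = N - n on are those of the n + 1
  -- smallest, and `ev j` bounds them all.
  refine ⟨hpos j, le_singularValue_sq (ι := Finset.Ici j) (u := fun i => vecEmbed (e i))
    (d := fun i => fourierEmbed μ (e i)) (c := fun i => ev i)
    (hu.comp _ Subtype.val_injective) (fun a b => ?_) (fun i => hTd i) (fun i => ?_) (hpos j) ?_⟩
  · simp only [hd, Subtype.ext_iff]
  · rw [hev]
    exact hT.eigenvalues_antitone _ (Finset.mem_Ici.1 i.2)
  · rw [Fintype.card_coe, Fin.card_Ici, hj]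
    simp
    omega

end Embedding

/-! ### Assembly of the theorem -/

theorem theorem4p4 (μ : Measure ℝ) (hmom : HasAllMoments μ) (hsupp : μ.support.Infinite)
    (hind : IsIndeterminate μ) :
    (∀ n : ℕ, Tendsto (fun N : ℕ => hankelEigenvalue μ N n) atTop (𝓝 (limitEigenvalue μ n)) ∧
      0 < limitEigenvalue μ n) ∧
    (∀ N n : ℕ, n ≤ N → 0 < hankelEigenvalue μ N n) ∧
    ∃ A B : EllTwo →L[ℂ] EllTwo,
      IsOperatorA μ A ∧ IsOperatorB μ B ∧
      IsCompactOperator A ∧ IsCompactOperator (ContinuousLinearMap.adjoint B) ∧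
      (∀ n N : ℕ, n ≤ N →
        singularValue A n = singularValue (ContinuousLinearMap.adjoint B) n ^ 2 ∧
        singularValue A n ≥ 1 / limitEigenvalue μ n ∧
        1 / limitEigenvalue μ n ≥ 1 / hankelEigenvalue μ N n) ∧
      Tendsto (fun n : ℕ => (n : ℝ) ^ 2 * singularValue A n ^ (1 / (n : ℝ))) atTop (𝓝 0) ∧
      Tendsto (fun n : ℕ => limitEigenvalue μ n ^ (1 / (n : ℝ)) / (n : ℝ) ^ 2) atTop atTop := by
  obtain ⟨h, h0, hs, hP⟩ := hind.exists_coeffSum_le hmom hsupp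
  obtain ⟨r, hrc, hr⟩ := exists_rows h0 hs hP
  have hcoef : ∀ k n, r k n = (((orthoPoly μ n).coeff k : ℝ) : ℂ) := fun k n => by
    rw [hrc, complexOrthoPoly, coeff_map]
    rfl
  obtain ⟨T, hT⟩ : ∃ T, T = columnOperator r := ⟨_, rfl⟩
  have hTc : IsCompactOperator T := hT ▸ isCompactOperator_columnOperator hr.summable_norm
  have hσ := singularValue_adjoint_comp_self hTc
  have hbound : ∀ {N n : ℕ}, n ≤ N → 0 < hankelEigenvalue μ N n ∧
      1 / hankelEigenvalue μ N n ≤ singularValue T n ^ 2 := fun hn =>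
    hT ▸ hankelEigenvalue_pos_and_le hmom hsupp hr.summable_norm hcoef hn
  have hσpos : ∀ n, 0 < singularValue T n ^ 2 := fun n =>
    (one_div_pos.2 (hbound le_rfl).1).trans_le (hbound le_rfl).2
  have hlow : ∀ {N n : ℕ}, n ≤ N → (singularValue T n ^ 2)⁻¹ ≤ hankelEigenvalue μ N n :=
    fun hn => inv_le_of_inv_le₀ (hbound hn).1 (by rw [← one_div]; exact (hbound hn).2)
  -- The shift by n skips the default values 0 taken for N < n, where monotonicity would fail.
  have hanti : ∀ n, Antitone fun N => hankelEigenvalue μ (N + n) n := fun n =>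
    antitone_nat_of_succ_le fun N => by
      rw [Nat.add_right_comm]
      exact hankelEigenvalue_succ_le μ (Nat.le_add_left n N)
  have hbdd : ∀ n, BddBelow (Set.range fun N => hankelEigenvalue μ (N + n) n) := fun n =>
    ⟨(singularValue T n ^ 2)⁻¹, by
      rintro _ ⟨N, rfl⟩
      exact hlow (Nat.le_add_left n N)⟩
  have hlim : ∀ n, Tendsto (fun N => hankelEigenvalue μ N n) atTop (𝓝 (limitEigenvalue μ n)) :=
    fun n => tendsto_nhds_limUnder
      ⟨_, (tendsto_add_atTop_iff_nat n).1 (tendsto_atTop_ciInf (hanti n) (hbdd n))⟩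
  have hlimlow : ∀ n, (singularValue T n ^ 2)⁻¹ ≤ limitEigenvalue μ n := fun n =>
    ge_of_tendsto (hlim n) ((eventually_ge_atTop n).mono fun N hN => hlow hN)
  have hlimpos : ∀ n, 0 < limitEigenvalue μ n := fun n =>
    (inv_pos.2 (hσpos n)).trans_le (hlimlow n)
  have hlimle : ∀ {N n : ℕ}, n ≤ N → limitEigenvalue μ n ≤ hankelEigenvalue μ N n := by
    intro N n hn
    refine le_of_tendsto (hlim n) ((eventually_ge_atTop N).mono fun M hM => ?_)
    have := hanti n (Nat.sub_le_sub_right hM n)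
    simpa only [Nat.sub_add_cancel hn, Nat.sub_add_cancel (hn.trans hM)] using this
  have hlim0 : Tendsto (fun n : ℕ => (n : ℝ) ^ 2 *
      (singularValue T n ^ 2) ^ (1 / (n : ℝ))) atTop (𝓝 0) := by
    have h1 := (hr.tendsto_mul_tail_rpow.pow 2)
    rw [zero_pow two_ne_zero] at h1
    refine squeeze_zero (fun n => ?_) (fun n => ?_) h1
    · have := hσpos n
      positivity
    · have h2 := singularValue_columnOperator_le hr.summable_norm n
      rw [← hT] at h2
      have h3 := singularValue_nonneg T n
      rw [mul_pow, ← Real.rpow_natCast_mul h3, mul_comm ((2 : ℕ) : ℝ), Real.rpow_mul_natCast h3]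
      gcongr
  -- A = T*T and B = T*, so that B* = T.
  refine ⟨fun n => ⟨hlim n, hlimpos n⟩, fun N n hn => (hbound hn).1,
    ContinuousLinearMap.adjoint T ∘L T, ContinuousLinearMap.adjoint T, ?_, ?_, ?_, ?_, ?_, ?_, ?_⟩
  · rw [hT]
    exact isOperatorA_adjoint_comp hr hcoef
  · intro k n
    rw [hT, entry_adjoint_columnOperator hr.summable_norm, hcoef, Complex.conj_ofReal]
  · exact hTc.clm_comp (ContinuousLinearMap.adjoint T)
  · rwa [ContinuousLinearMap.adjoint_adjoint]
  · intro n N hn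
    rw [ContinuousLinearMap.adjoint_adjoint, hσ]
    refine ⟨rfl, ?_, one_div_le_one_div_of_le (hlimpos n) (hlimle hn)⟩
    rw [ge_iff_le, one_div]
    exact inv_le_of_inv_le₀ (hσpos n) (hlimlow n)
  · simpa only [hσ] using hlim0
  · have h1 : Tendsto (fun n : ℕ => ((n : ℝ) ^ 2 *
        (singularValue T n ^ 2) ^ (1 / (n : ℝ)))⁻¹) atTop atTop := by
      refine Tendsto.inv_tendsto_nhdsGT_zero (tendsto_nhdsWithin_iff.2 ⟨hlim0, ?_⟩)
      filter_upwards [eventually_gt_atTop 0] with n hn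
      have := hσpos n
      have : (0 : ℝ) < n := by exact_mod_cast hn
      exact Set.mem_Ioi.2 (by positivity)
    -- Since λ_{∞,n} ≥ σ_n(T)⁻², the sequence dominates the inverse of the one just shown to tend to
    -- 0.
    refine tendsto_atTop_mono (fun n => ?_) h1
    rw [mul_inv, mul_comm, ← div_eq_mul_inv, ← Real.inv_rpow (hσpos n).le]
    have := hlimlow n
    have := hσpos n
    gcongr
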